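/- Let $\mathfrak g=\mathfrak{sl}(2,\mathbb C)$ with standard basis $\mathbf e,\mathbf h,\mathbf f$, and let $\mathbb F=\mathbb C[x,y,\zeta^{\pm1}]$ be the commutative algebra of regular functions on the big Bruhat cell $$G_0=\left\{\begin{pmatrix}1&x\\0&1\end{pmatrix}\begin{pmatrix}0&-1\\1&0\end{pmatrix}\begin{pmatrix}\zeta&0\\0&\zeta^{-1}\end{pmatrix}\begin{pmatrix}1&y\\0&1\end{pmatrix}\;:\;x,y\in\mathbb C,\ \zeta\in\mathbb C^\times\right\}\subset SL(2,\mathbb C).$$ The left and right infinitesimal regular actions of $\mathfrak g$ on $\mathbb F$ are the commuting actions by derivations $$\pi_l(\mathbf e)=-\partial_x,\quad \pi_l(\mathbf h)=\zeta\partial_\zeta-2x\partial_x,\quad \pi_l(\mathbf f)=-x\zeta\partial_\zeta+x^2\partial_x+\zeta^{-2}\partial_y,$$ $$\pi_r(\mathbf e)=\partial_y,\quad \pi_r(\mathbf h)=\zeta\partial_\zeta-2y\partial_y,\quad \pi_r(\mathbf f)=y\zeta\partial_\zeta-y^2\partial_y-\zeta^{-2}\partial_x,$$ and $\mathfrak g$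 acts on $\mathbb F$ diagonally, by $\pi_l+\pi_r$. For a commutative algebra $A$ on which $\mathfrak g$ acts by derivations through $\pi_A$, let $H^\bullet(\mathfrak g;A)$ be the cohomology of $\bigwedge^\bullet\mathfrak g'\otimes A$ with differential $$\mathbf d=\sum_i\varepsilon(g_i')\pi_A(g_i)-\tfrac12\sum_{i,j}\varepsilon(g_i')\varepsilon(g_j')\iota([g_i,g_j])$$ ($\{g_i\}$ a basis of $\mathfrak g$, $\{g_i'\}$ the dual basis of the dual space $\mathfrak g'$, $\varepsilon$ exterior multiplication, $\iota$ contraction), with the multiplication induced from $\bigwedge\mathfrak g'$ and $A$. Let $\mathbf P\cong\mathbb Z$ be the weight lattice and let the Weyl group $W\cong\mathbb Z/2$ act on the group algebra $\mathbb C[\mathbf P]$ through $\lambda\mapsto-\lambda$. **Theorem.** There is an isomorphism of graded commutative superalgebras over $\mathbb C$ $$H^\bullet(\mathfrak g;\mathbb F)\;\cong\;\mathbb C[\mathbf P]^W\otimes\textstyle\bigwedge^\bullet\mathbb C^2,$$ where $\mathbb C[\mathbf P]^W$ is placed in degree $0$ and $\mathbb C^2$ in degree $1$. In contrast to the case of finite-dimensional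 coefficient modules, $H^\bullet(\mathfrak g;\mathbb F)$ is not isomorphic, even as a graded vector space, to $\mathbb F^{\mathfrak g}\otimes H^\bullet(\mathfrak g;\mathbb C)$, where $\mathfrak g$ acts trivially on $\mathbb C$ (here $H^\bullet(\mathfrak g;\mathbb C)\cong H^\bullet_{DR}(SL(2,\mathbb C))$ is the de Rham cohomology of the group). -/

import Mathlib

open scoped TensorProduct LaurentPolynomial

noncomputable section

/-! ## Lie algebra cohomology with coefficients in a commutative algebra -/

namespace LieCohomology

section Complex

variable {g A ι : Type} [LieRing g] [LieAlgebra ℂ g] [CommRing A] [Algebra ℂ A] [Fintype ι]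

/-- The cochains `⋀ g' ⊗ A`.  As `A` is purely even, the ordinary multiplication of the tensor
product is the multiplication of the tensor product of superalgebras. -/
abbrev Cochains (g A : Type) [LieRing g] [LieAlgebra ℂ g] [CommRing A] [Algebra ℂ A] : Type :=
  ExteriorAlgebra ℂ (Module.Dual ℂ g) ⊗[ℂ] A

/-- The operator `ε(φ)` of exterior multiplication by `φ ∈ g'` on `⋀ g'`. -/
def wedge (φ : Module.Dual ℂ g) :
    ExteriorAlgebra ℂ (Module.Dual ℂ g) →ₗ[ℂ] ExteriorAlgebra ℂ (Module.Dual ℂ g) :=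
  LinearMap.mulLeft ℂ (ExteriorAlgebra.ι ℂ φ)

/-- The operator `ι(x)` of contraction with `x ∈ g` on `⋀ g'`: it kills `1` and satisfies
`{ι(x), ε(φ)} = φ(x)`. -/
def contract (x : g) :
    ExteriorAlgebra ℂ (Module.Dual ℂ g) →ₗ[ℂ] ExteriorAlgebra ℂ (Module.Dual ℂ g) :=
  CliffordAlgebra.contractLeft (Q := (0 : QuadraticForm ℂ (Module.Dual ℂ g)))
    (Module.Dual.eval ℂ g x)

/-- The differential
`d = ∑ i, ε(g'ᵢ) π(gᵢ) - 1/2 ∑ i j, ε(g'ᵢ) ε(g'ⱼ) ι([gᵢ, gⱼ])`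
for a basis `gᵢ` of `g` with dual basis `g'ᵢ`, where `g` acts on the commutative algebra `A` by
derivations through the Lie algebra homomorphism `π`. -/
def differential (b : Module.Basis ι ℂ g) (π : g →ₗ⁅ℂ⁆ Derivation ℂ A A) :
    Cochains g A →ₗ[ℂ] Cochains g A :=
  ∑ i, TensorProduct.map (wedge (b.coord i)) (π (b i) : A →ₗ[ℂ] A) -
    (1 / 2 : ℂ) • ∑ i, ∑ j,
      TensorProduct.map (wedge (b.coord i) ∘ₗ wedge (b.coord j) ∘ₗ contract ⁅b i, b j⁆)
        (LinearMap.id : A →ₗ[ℂ] A)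

/-- The parity automorphism `(-1)^deg` of the cochains. -/
def parity (g A : Type) [LieRing g] [LieAlgebra ℂ g] [CommRing A] [Algebra ℂ A] :
    Cochains g A →ₐ[ℂ] Cochains g A :=
  Algebra.TensorProduct.map
    (CliffordAlgebra.involute (Q := (0 : QuadraticForm ℂ (Module.Dual ℂ g)))) (AlgHom.id ℂ A)

theorem involute_iota (φ : Module.Dual ℂ g) :
    CliffordAlgebra.involute (Q := (0 : QuadraticForm ℂ (Module.Dual ℂ g)))
      (ExteriorAlgebra.ι ℂ φ) = -ExteriorAlgebra.ι ℂ φ :=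
  CliffordAlgebra.involute_ι φ

theorem wedge_apply (φ : Module.Dual ℂ g) (u : ExteriorAlgebra ℂ (Module.Dual ℂ g)) :
    wedge φ u = ExteriorAlgebra.ι ℂ φ * u := rfl

theorem contract_one (x : g) : contract x 1 = 0 :=
  CliffordAlgebra.contractLeft_one (Q := (0 : QuadraticForm ℂ (Module.Dual ℂ g))) _

theorem contract_iota_mul (x : g) (φ : Module.Dual ℂ g)
    (u : ExteriorAlgebra ℂ (Module.Dual ℂ g)) :
    contract x (ExteriorAlgebra.ι ℂ φ * u) = φ x • u - ExteriorAlgebra.ι ℂ φ * contract x u :=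
  CliffordAlgebra.contractLeft_ι_mul _ _ _

theorem iota_mul (φ : Module.Dual ℂ g) (u : ExteriorAlgebra ℂ (Module.Dual ℂ g)) :
    ExteriorAlgebra.ι ℂ φ * u =
      CliffordAlgebra.involute (Q := (0 : QuadraticForm ℂ (Module.Dual ℂ g))) u *
        ExteriorAlgebra.ι ℂ φ := by
  induction u using ExteriorAlgebra.induction with
  | algebraMap r => rw [AlgHom.commutes, Algebra.commutes]
  | ι ψ =>
    rw [involute_iota, neg_mul, eq_neg_iff_add_eq_zero]
    exact ExteriorAlgebra.ι_add_mul_swap φ ψ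
  | mul a b ha hb => rw [map_mul, ← mul_assoc, ha, mul_assoc, hb, mul_assoc]
  | add a b ha hb => rw [map_add, mul_add, add_mul, ha, hb]

theorem contract_mul (x : g) (u v : ExteriorAlgebra ℂ (Module.Dual ℂ g)) :
    contract x (u * v) = contract x u * v +
      CliffordAlgebra.involute (Q := (0 : QuadraticForm ℂ (Module.Dual ℂ g))) u *
        contract x v := by
  induction u using CliffordAlgebra.left_induction with
  | algebraMap r =>
    rw [AlgHom.commutes, ← Algebra.smul_def, map_smul, Algebra.algebraMap_eq_smul_one, map_smul]
    erw [contract_one]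
    simp
  | add a b ha hb => simp only [add_mul, map_add, ha, hb]; abel
  | ι_mul a φ ha =>
    have h1 := contract_iota_mul x φ (a * v)
    have h2 := contract_iota_mul x φ a
    have h3 := involute_iota φ
    change contract x (ExteriorAlgebra.ι ℂ φ * a * v) =
      contract x (ExteriorAlgebra.ι ℂ φ * a) * v +
      CliffordAlgebra.involute (Q := (0 : QuadraticForm ℂ (Module.Dual ℂ g)))
        (ExteriorAlgebra.ι ℂ φ * a) * contract x v
    rw [mul_assoc, h1, h2, map_mul CliffordAlgebra.involute, h3, ha]
    simp only [sub_mul, mul_add, neg_mul, mul_assoc, smul_mul_assoc]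
    abel

theorem parity_contract (x : g) (u : ExteriorAlgebra ℂ (Module.Dual ℂ g)) :
    contract x (CliffordAlgebra.involute (Q := (0 : QuadraticForm ℂ (Module.Dual ℂ g))) u) =
      -CliffordAlgebra.involute (Q := (0 : QuadraticForm ℂ (Module.Dual ℂ g)))
        (contract x u) := by
  induction u using CliffordAlgebra.left_induction with
  | algebraMap r =>
    rw [AlgHom.commutes, Algebra.algebraMap_eq_smul_one, map_smul]
    erw [contract_one]
    simp
  | add a b ha hb => simp only [map_add, ha, hb]; abel
  | ι_mul a φ ha =>
    have h3 := involute_iota φ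
    change contract x (CliffordAlgebra.involute (Q := (0 : QuadraticForm ℂ (Module.Dual ℂ g)))
        (ExteriorAlgebra.ι ℂ φ * a)) =
      -CliffordAlgebra.involute (Q := (0 : QuadraticForm ℂ (Module.Dual ℂ g)))
        (contract x (ExteriorAlgebra.ι ℂ φ * a))
    rw [map_mul CliffordAlgebra.involute, h3, contract_iota_mul, map_sub, map_smul,
      map_mul CliffordAlgebra.involute, h3, neg_mul, map_neg, contract_iota_mul, ha]
    simp

/-- The differential is an odd derivation. -/
theorem differential_mul (b : Module.Basis ι ℂ g) (π : g →ₗ⁅ℂ⁆ Derivation ℂ A A)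
    (u v : Cochains g A) :
    differential b π (u * v) = differential b π u * v + parity g A u * differential b π v := by
  induction u using TensorProduct.induction_on with
  | zero => simp
  | add u₁ u₂ h₁ h₂ => simp only [add_mul, map_add, h₁, h₂]; abel
  | tmul ω a =>
  induction v using TensorProduct.induction_on with
  | zero => simp
  | add v₁ v₂ h₁ h₂ => simp only [mul_add, map_add, h₁, h₂]; abel
  | tmul η c =>
  have e1 : ∀ i, TensorProduct.map (wedge (b.coord i)) (π (b i) : A →ₗ[ℂ] A)
        ((ω * η) ⊗ₜ[ℂ] (a * c)) =
      TensorProduct.map (wedge (b.coord i)) (π (b i) : A →ₗ[ℂ] A) (ω ⊗ₜ[ℂ] a) * (η ⊗ₜ[ℂ] c) +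
      parity g A (ω ⊗ₜ[ℂ] a) *
        TensorProduct.map (wedge (b.coord i)) (π (b i) : A →ₗ[ℂ] A) (η ⊗ₜ[ℂ] c) := by
    intro i
    simp only [parity, TensorProduct.map_tmul, Algebra.TensorProduct.map_tmul, wedge_apply,
      Algebra.TensorProduct.tmul_mul_tmul, Derivation.coeFn_coe, Derivation.leibniz,
      AlgHom.id_apply, smul_eq_mul, TensorProduct.tmul_add]
    rw [← mul_assoc, ← mul_assoc, ← iota_mul, mul_comm c, add_comm]
  have e2 : ∀ i j, TensorProduct.map
        (wedge (b.coord i) ∘ₗ wedge (b.coord j) ∘ₗ contract ⁅b i, b j⁆)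
        (LinearMap.id : A →ₗ[ℂ] A) ((ω * η) ⊗ₜ[ℂ] (a * c)) =
      TensorProduct.map (wedge (b.coord i) ∘ₗ wedge (b.coord j) ∘ₗ contract ⁅b i, b j⁆)
        (LinearMap.id : A →ₗ[ℂ] A) (ω ⊗ₜ[ℂ] a) * (η ⊗ₜ[ℂ] c) +
      parity g A (ω ⊗ₜ[ℂ] a) *
        TensorProduct.map (wedge (b.coord i) ∘ₗ wedge (b.coord j) ∘ₗ contract ⁅b i, b j⁆)
        (LinearMap.id : A →ₗ[ℂ] A) (η ⊗ₜ[ℂ] c) := by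
    intro i j
    simp only [parity, TensorProduct.map_tmul, Algebra.TensorProduct.map_tmul, wedge_apply,
      Algebra.TensorProduct.tmul_mul_tmul, LinearMap.comp_apply, LinearMap.id_apply,
      AlgHom.id_apply, contract_mul, mul_add, TensorProduct.add_tmul]
    congr 2
    · simp only [mul_assoc]
    · simp only [← mul_assoc]
      rw [mul_assoc (ExteriorAlgebra.ι ℂ (b.coord i)), iota_mul (b.coord j), ← mul_assoc,
        iota_mul (b.coord i), CliffordAlgebra.involute_involute]
  simp only [differential, LinearMap.sub_apply, LinearMap.smul_apply, LinearMap.sum_apply,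
    Algebra.TensorProduct.tmul_mul_tmul, e1, e2, Finset.sum_add_distrib, smul_add, sub_mul, mul_sub,
    Finset.sum_mul, Finset.mul_sum, smul_mul_assoc, mul_smul_comm]
  abel

theorem differential_parity (b : Module.Basis ι ℂ g) (π : g →ₗ⁅ℂ⁆ Derivation ℂ A A)
    (u : Cochains g A) :
    differential b π (parity g A u) = -parity g A (differential b π u) := by
  induction u using TensorProduct.induction_on with
  | zero => simp
  | add u₁ u₂ h₁ h₂ => simp only [map_add, h₁, h₂]; abel
  | tmul ω a =>
  simp only [differential, parity, LinearMap.sub_apply, LinearMap.smul_apply, LinearMap.sum_apply,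
    TensorProduct.map_tmul, Algebra.TensorProduct.map_tmul, LinearMap.comp_apply, map_sub, map_sum,
    map_smul, wedge_apply, parity_contract, map_mul, involute_iota, LinearMap.id_apply,
    AlgHom.id_apply, mul_neg, neg_mul, TensorProduct.neg_tmul, neg_neg, Finset.sum_neg_distrib,
    smul_neg]
  abel

theorem differential_one (b : Module.Basis ι ℂ g) (π : g →ₗ⁅ℂ⁆ Derivation ℂ A A) :
    differential b π 1 = 0 := by
  have h := differential_mul b π 1 1
  rw [map_one (parity g A), mul_one, one_mul, mul_one] at h
  simpa using h

theorem parity_parity (u : Cochains g A) : parity g A (parity g A u) = u := by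
  induction u using TensorProduct.induction_on with
  | zero => simp
  | add u₁ u₂ h₁ h₂ => simp only [map_add, h₁, h₂]
  | tmul ω a =>
    simp only [parity, Algebra.TensorProduct.map_tmul, AlgHom.id_apply,
      CliffordAlgebra.involute_involute]

/-- The algebra of cocycles `ker d`. -/
def cocycles (b : Module.Basis ι ℂ g) (π : g →ₗ⁅ℂ⁆ Derivation ℂ A A) :
    Subalgebra ℂ (Cochains g A) where
  carrier := {u | differential b π u = 0}
  mul_mem' {u v} hu hv := by
    simp only [Set.mem_ofPred_eq] at hu hv ⊢
    rw [differential_mul, hu, hv, zero_mul, mul_zero, add_zero]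
  add_mem' {u v} hu hv := by
    simp only [Set.mem_ofPred_eq] at hu hv ⊢
    rw [map_add, hu, hv, add_zero]
  algebraMap_mem' r := by
    simp only [Set.mem_ofPred_eq]
    rw [Algebra.algebraMap_eq_smul_one, map_smul, differential_one, smul_zero]

/-- The ideal of coboundaries `im d` in the algebra of cocycles. -/
def coboundaries (b : Module.Basis ι ℂ g) (π : g →ₗ⁅ℂ⁆ Derivation ℂ A A) :
    Ideal (cocycles b π) where
  carrier := {z | ∃ u, differential b π u = (z : Cochains g A)}
  zero_mem' := ⟨0, by simp⟩
  add_mem' := by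
    rintro z w ⟨u, hu⟩ ⟨v, hv⟩
    exact ⟨u + v, by rw [map_add, hu, hv]; rfl⟩
  smul_mem' := by
    rintro z w ⟨u, hu⟩
    have hz : differential b π (z : Cochains g A) = 0 := z.2
    refine ⟨parity g A z * u, ?_⟩
    rw [differential_mul, differential_parity, hz, map_zero, neg_zero, zero_mul, zero_add,
      parity_parity, hu]
    rfl

instance coboundaries_isTwoSided (b : Module.Basis ι ℂ g) (π : g →ₗ⁅ℂ⁆ Derivation ℂ A A) :
    (coboundaries b π).IsTwoSided where
  mul_mem_of_left := by
    rintro z w ⟨u, hu⟩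
    have hw : differential b π (w : Cochains g A) = 0 := w.2
    refine ⟨u * w, ?_⟩
    rw [differential_mul, hw, mul_zero, add_zero, hu]
    rfl

/-- The cohomology algebra `H^•(g; A)`, with the multiplication induced from `⋀ g'` and `A`. -/
abbrev Cohomology (b : Module.Basis ι ℂ g) (π : g →ₗ⁅ℂ⁆ Derivation ℂ A A) : Type :=
  cocycles b π ⧸ coboundaries b π

/-- The cochains `⋀ⁿ g' ⊗ A` of degree `n`. -/
def cochainsDeg (g A : Type) [LieRing g] [LieAlgebra ℂ g] [CommRing A] [Algebra ℂ A] (n : ℕ) :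
    Submodule ℂ (Cochains g A) :=
  LinearMap.range (TensorProduct.map (⋀[ℂ]^n (Module.Dual ℂ g)).subtype
    (LinearMap.id : A →ₗ[ℂ] A))

/-- The cohomology `Hⁿ(g; A)`: the classes of the cocycles of degree `n`. -/
def cohomologyDeg (b : Module.Basis ι ℂ g) (π : g →ₗ⁅ℂ⁆ Derivation ℂ A A) (n : ℕ) :
    Submodule ℂ (Cohomology b π) :=
  ((cochainsDeg g A n).comap (cocycles b π).val.toLinearMap).map
    (Ideal.Quotient.mkₐ ℂ (coboundaries b π)).toLinearMap

/-- The space `A^g` of invariants. -/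
def invariants (π : g →ₗ⁅ℂ⁆ Derivation ℂ A A) : Submodule ℂ A where
  carrier := {a | ∀ x, π x a = 0}
  zero_mem' x := map_zero _
  add_mem' {a c} ha hc x := by rw [map_add, ha x, hc x, add_zero]
  smul_mem' r a ha x := by rw [Derivation.map_smul, ha x, smul_zero]

end Complex

end LieCohomology

/-! ## The Lie algebra `sl₂` -/

/-- The Lie algebra `sl(2, ℂ)` of traceless matrices. -/
abbrev SL2 : Type := LieAlgebra.SpecialLinear.sl (Fin 2) ℂ

namespace SL2

theorem val_one_one (X : SL2) : X.val 1 1 = -X.val 0 0 := by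
  have h : Matrix.trace X.val = 0 := X.2
  rw [Matrix.trace_fin_two] at h
  linear_combination h

/-- The element of `sl₂` with coordinates `p, q, r` with respect to `e, h, f`. -/
def ofCoords (p q r : ℂ) : SL2 :=
  ⟨!![q, p; r, -q], by
    change Matrix.trace (!![q, p; r, -q] : Matrix (Fin 2) (Fin 2) ℂ) = 0
    simp [Matrix.trace_fin_two]⟩

/-- The coordinates with respect to `e, h, f`. -/
def coords : SL2 ≃ₗ[ℂ] (Fin 3 → ℂ) where
  toFun X := ![X.val 0 1, X.val 0 0, X.val 1 0]
  map_add' X Y := by ext i; fin_cases i <;> simp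
  map_smul' c X := by ext i; fin_cases i <;> simp
  invFun v := ofCoords (v 0) (v 1) (v 2)
  left_inv X := by
    apply Subtype.ext
    ext i j
    fin_cases i <;> fin_cases j <;> simp [ofCoords, val_one_one]
  right_inv v := by ext i; fin_cases i <;> simp [ofCoords]

/-- The standard basis `e, h, f` of `sl₂`. -/
def basis : Module.Basis (Fin 3) ℂ SL2 := Module.Basis.ofEquivFun coords

/-- The homomorphism from `sl₂` to a Lie algebra sending `e, h, f` to given elements satisfying
`[h, e] = 2e`, `[h, f] = -2f`, `[e, f] = h`. -/
def lift {L : Type} [LieRing L] [LieAlgebra ℂ L] (E H F : L)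
    (hHE : ⁅H, E⁆ = (2 : ℂ) • E) (hHF : ⁅H, F⁆ = (-2 : ℂ) • F) (hEF : ⁅E, F⁆ = H) :
    SL2 →ₗ⁅ℂ⁆ L where
  toFun X := X.val 0 1 • E + X.val 0 0 • H + X.val 1 0 • F
  map_add' X Y := by
    change (X.val 0 1 + Y.val 0 1) • E + (X.val 0 0 + Y.val 0 0) • H +
      (X.val 1 0 + Y.val 1 0) • F = _
    module
  map_smul' c X := by
    change (c * X.val 0 1) • E + (c * X.val 0 0) • H + (c * X.val 1 0) • F = c • _
    module
  map_lie' {X Y} := by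
    have hEH : ⁅E, H⁆ = (-2 : ℂ) • E := by rw [← lie_skew, hHE, neg_smul]
    have hFH : ⁅F, H⁆ = (2 : ℂ) • F := by rw [← lie_skew, hHF, neg_smul, neg_neg]
    have hFE : ⁅F, E⁆ = -H := by rw [← lie_skew, hEF]
    change (X.val * Y.val - Y.val * X.val) 0 1 • E + (X.val * Y.val - Y.val * X.val) 0 0 • H +
      (X.val * Y.val - Y.val * X.val) 1 0 • F = _
    simp only [Matrix.sub_apply, Matrix.mul_apply, Fin.sum_univ_two, val_one_one, lie_add, add_lie,
      lie_smul, smul_lie, lie_self, hHE, hHF, hEF, hEH, hFH, hFE]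
    module

theorem lift_commute {L : Type} [LieRing L] [LieAlgebra ℂ L] {E H F E' H' F' : L} (hHE hHF hEF)
    (hHE' hHF' hEF') (h1 : ⁅E, E'⁆ = 0 ∧ ⁅E, H'⁆ = 0 ∧ ⁅E, F'⁆ = 0)
    (h2 : ⁅H, E'⁆ = 0 ∧ ⁅H, H'⁆ = 0 ∧ ⁅H, F'⁆ = 0)
    (h3 : ⁅F, E'⁆ = 0 ∧ ⁅F, H'⁆ = 0 ∧ ⁅F, F'⁆ = 0) (X Y : SL2) :
    ⁅lift E H F hHE hHF hEF X, lift E' H' F' hHE' hHF' hEF' Y⁆ = 0 := by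
  change ⁅X.val 0 1 • E + X.val 0 0 • H + X.val 1 0 • F,
    Y.val 0 1 • E' + Y.val 0 0 • H' + Y.val 1 0 • F'⁆ = 0
  simp only [lie_add, add_lie, lie_smul, smul_lie, h1, h2, h3, smul_zero, add_zero]

/-- The sum of two commuting homomorphisms. -/
def sum {L : Type} [LieRing L] [LieAlgebra ℂ L] (φ ψ : SL2 →ₗ⁅ℂ⁆ L)
    (h : ∀ X Y, ⁅φ X, ψ Y⁆ = 0) : SL2 →ₗ⁅ℂ⁆ L where
  toFun X := φ X + ψ X
  map_add' X Y := by rw [map_add, map_add]; abel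
  map_smul' c X := by rw [map_smul, map_smul, smul_add]; rfl
  map_lie' {X Y} := by
    have h' : ⁅ψ X, φ Y⁆ = 0 := by rw [← lie_skew, h, neg_zero]
    rw [LieHom.map_lie, LieHom.map_lie, lie_add, add_lie, add_lie, h, h', add_zero, zero_add]

end SL2

/-! ## The extended regular representation on the big cell -/

namespace BigCell

/-- The algebra `ℂ[x, y, ζ, ζ⁻¹]` of regular functions on the big cell
`{ [1, x; 0, 1] [0, -1; 1, 0] [ζ, 0; 0, ζ⁻¹] [1, y; 0, 1] }` of `SL(2, ℂ)`;
`T λ` is the function `ζ^λ`. -/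
abbrev Functions : Type := LaurentPolynomial (MvPolynomial (Fin 2) ℂ)

/-- The coordinate function `x`. -/
def x : Functions := LaurentPolynomial.C (MvPolynomial.X 0)

/-- The coordinate function `y`. -/
def y : Functions := LaurentPolynomial.C (MvPolynomial.X 1)

/-- The functions `ζ^λ`. -/
def zeta (l : ℤ) : Functions := LaurentPolynomial.T l

theorem functions_induction {M : Functions → Prop} (u : Functions)
    (hC : ∀ c : ℂ, M (algebraMap ℂ Functions c)) (hx : M x) (hy : M y) (hz : ∀ l, M (zeta l))
    (hadd : ∀ p q, M p → M q → M (p + q)) (hmul : ∀ p q, M p → M q → M (p * q)) : M u := by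
  induction u using LaurentPolynomial.induction_on' with
  | add p q hp hq => exact hadd p q hp hq
  | C_mul_T n a =>
    refine hmul _ _ ?_ (hz n)
    induction a using MvPolynomial.induction_on with
    | C c => exact hC c
    | add p q hp hq => rw [map_add]; exact hadd _ _ hp hq
    | mul_X p i hp =>
      rw [map_mul]
      refine hmul _ _ hp ?_
      fin_cases i
      · exact hx
      · exact hy

/-- Derivations of `ℂ[x, y, ζ, ζ⁻¹]` are determined by their values on the coordinates. -/
theorem derivation_ext {D E : Derivation ℂ Functions Functions} (hx : D x = E x) (hy : D y = E y)
    (hz : ∀ l, D (zeta l) = E (zeta l)) : D = E := by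
  apply Derivation.ext
  intro u
  induction u using functions_induction with
  | hC c => rw [Derivation.map_algebraMap, Derivation.map_algebraMap]
  | hx => exact hx
  | hy => exact hy
  | hz l => exact hz l
  | hadd p q hp hq => rw [map_add, map_add, hp, hq]
  | hmul p q hp hq => rw [Derivation.leibniz, Derivation.leibniz, hp, hq]

theorem leibniz_of_basis (D : Functions →ₗ[ℂ] Functions)
    (h : ∀ p q m n, D (LaurentPolynomial.C p * LaurentPolynomial.T m *
        (LaurentPolynomial.C q * LaurentPolynomial.T n)) =
      (LaurentPolynomial.C p * LaurentPolynomial.T m) *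
        D (LaurentPolynomial.C q * LaurentPolynomial.T n) +
      (LaurentPolynomial.C q * LaurentPolynomial.T n) *
        D (LaurentPolynomial.C p * LaurentPolynomial.T m)) (u v : Functions) :
    D (u * v) = u • D v + v • D u := by
  simp only [smul_eq_mul]
  induction u using LaurentPolynomial.induction_on' with
  | add p q hp hq => simp only [add_mul, mul_add, map_add, hp, hq]; abel
  | C_mul_T m p =>
  induction v using LaurentPolynomial.induction_on' with
  | add p q hp hq => simp only [add_mul, mul_add, map_add, hp, hq]; abel
  | C_mul_T n q => exact h p q m n

theorem C_mul_T_mul (p q : MvPolynomial (Fin 2) ℂ) (m n : ℤ) :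
    (LaurentPolynomial.C p * LaurentPolynomial.T m *
      (LaurentPolynomial.C q * LaurentPolynomial.T n) : Functions) =
    LaurentPolynomial.C (p * q) * LaurentPolynomial.T (m + n) := by
  rw [LaurentPolynomial.T_add, map_mul]; ring

/-- The linear map on `ℂ[x, y, ζ, ζ⁻¹]` with `p(x, y) ζ^λ ↦ (L λ p)(x, y) ζ^λ`. -/
def coeffMap (L : ℤ → MvPolynomial (Fin 2) ℂ →ₗ[ℂ] MvPolynomial (Fin 2) ℂ) :
    Functions →ₗ[ℂ] Functions :=
  Finsupp.lsum ℂ (fun l => ((AddMonoidAlgebra.lsingle l :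
      MvPolynomial (Fin 2) ℂ →ₗ[MvPolynomial (Fin 2) ℂ] Functions).restrictScalars ℂ) ∘ₗ L l) ∘ₗ
    (AddMonoidAlgebra.coeffLinearEquiv ℂ).toLinearMap

theorem coeffMap_C_mul_T (L : ℤ → MvPolynomial (Fin 2) ℂ →ₗ[ℂ] MvPolynomial (Fin 2) ℂ)
    (p : MvPolynomial (Fin 2) ℂ) (l : ℤ) :
    coeffMap L (LaurentPolynomial.C p * LaurentPolynomial.T l) =
      LaurentPolynomial.C (L l p) * LaurentPolynomial.T l := by
  rw [← LaurentPolynomial.single_eq_C_mul_T, ← LaurentPolynomial.single_eq_C_mul_T]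
  change Finsupp.lsum ℂ _ (Finsupp.single l p) = _
  rw [Finsupp.lsum_single]
  rfl

/-- The partial derivative with respect to `x` (for `i = 0`) or `y` (for `i = 1`). -/
def partialDeriv (i : Fin 2) : Derivation ℂ Functions Functions :=
  Derivation.mk' (coeffMap fun _ => (MvPolynomial.pderiv i : Derivation ℂ _ _)) <|
    leibniz_of_basis _ fun p q m n => by
      rw [C_mul_T_mul, coeffMap_C_mul_T, coeffMap_C_mul_T, coeffMap_C_mul_T]
      simp only [Derivation.coeFn_coe, Derivation.leibniz,
        LaurentPolynomial.T_add, map_add, smul_eq_mul, map_mul]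
      ring

/-- The Euler derivation `a = ζ ∂/∂ζ`. -/
def euler : Derivation ℂ Functions Functions :=
  Derivation.mk' (coeffMap fun l => (l : ℂ) • LinearMap.id) <|
    leibniz_of_basis _ fun p q m n => by
      rw [C_mul_T_mul, coeffMap_C_mul_T, coeffMap_C_mul_T, coeffMap_C_mul_T]
      simp only [LinearMap.smul_apply, LinearMap.id_apply,
        LaurentPolynomial.T_add, map_mul, MvPolynomial.smul_eq_C_mul, Int.cast_add, map_add]
      ring

theorem x_eq : x = LaurentPolynomial.C (MvPolynomial.X 0) * LaurentPolynomial.T 0 := by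
  rw [LaurentPolynomial.T_zero, mul_one]; rfl

theorem y_eq : y = LaurentPolynomial.C (MvPolynomial.X 1) * LaurentPolynomial.T 0 := by
  rw [LaurentPolynomial.T_zero, mul_one]; rfl

theorem zeta_eq (l : ℤ) : zeta l = LaurentPolynomial.C 1 * LaurentPolynomial.T l := by
  rw [map_one, one_mul]; rfl

theorem zeta_add (k l : ℤ) : zeta (k + l) = zeta k * zeta l := LaurentPolynomial.T_add k l

theorem zeta_zero : zeta 0 = 1 := LaurentPolynomial.T_zero

theorem partialDeriv_x_x : partialDeriv 0 x = 1 := by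
  rw [x_eq, partialDeriv, Derivation.coe_mk', coeffMap_C_mul_T]; simp

theorem partialDeriv_x_y : partialDeriv 0 y = 0 := by
  rw [y_eq, partialDeriv, Derivation.coe_mk', coeffMap_C_mul_T]; simp

theorem partialDeriv_y_x : partialDeriv 1 x = 0 := by
  rw [x_eq, partialDeriv, Derivation.coe_mk', coeffMap_C_mul_T]; simp

theorem partialDeriv_y_y : partialDeriv 1 y = 1 := by
  rw [y_eq, partialDeriv, Derivation.coe_mk', coeffMap_C_mul_T]; simp

theorem partialDeriv_zeta (i : Fin 2) (l : ℤ) : partialDeriv i (zeta l) = 0 := by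
  rw [zeta_eq, partialDeriv, Derivation.coe_mk', coeffMap_C_mul_T]; simp

theorem euler_x : euler x = 0 := by
  rw [x_eq, euler, Derivation.coe_mk', coeffMap_C_mul_T]; simp

theorem euler_y : euler y = 0 := by
  rw [y_eq, euler, Derivation.coe_mk', coeffMap_C_mul_T]; simp

theorem euler_zeta (l : ℤ) : euler (zeta l) = (l : Functions) * zeta l := by
  rw [zeta_eq, euler, Derivation.coe_mk', coeffMap_C_mul_T]
  simp [MvPolynomial.smul_eq_C_mul]

/-- The left action of `e, h, f`: with `β = x`, `γ = -∂/∂x`, `γ' = ∂/∂y` and `a = ζ ∂/∂ζ`, these are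
`γ`, `2βγ + a` and `-β²γ - βa + γ' ζ⁻²`. -/
def leftE : Derivation ℂ Functions Functions := -partialDeriv 0

/-- The left action of `h`. -/
def leftH : Derivation ℂ Functions Functions := euler - (2 : ℂ) • (x • partialDeriv 0)

/-- The left action of `f`. -/
def leftF : Derivation ℂ Functions Functions :=
  -(x • euler) + (x * x) • partialDeriv 0 + zeta (-2) • partialDeriv 1

/-- The right action of `e, h, f`: with `β' = -y`, `γ' = ∂/∂y`, `γ = -∂/∂x` and `a = ζ ∂/∂ζ`, these
are `γ'`, `2β'γ' + a` and `-β'²γ' - β'a + γ ζ⁻²`. -/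
def rightE : Derivation ℂ Functions Functions := partialDeriv 1

/-- The right action of `h`. -/
def rightH : Derivation ℂ Functions Functions := euler - (2 : ℂ) • (y • partialDeriv 1)

/-- The right action of `f`. -/
def rightF : Derivation ℂ Functions Functions :=
  y • euler - (y * y) • partialDeriv 1 - zeta (-2) • partialDeriv 0

/-- The left and the right operators satisfy the relations of `sl₂`, and they commute. -/
theorem commutators :
    (⁅leftH, leftE⁆ = (2 : ℂ) • leftE ∧ ⁅leftH, leftF⁆ = (-2 : ℂ) • leftF ∧
      ⁅leftE, leftF⁆ = leftH) ∧
    (⁅rightH, rightE⁆ = (2 : ℂ) • rightE ∧ ⁅rightH, rightF⁆ = (-2 : ℂ) • rightF ∧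
      ⁅rightE, rightF⁆ = rightH) ∧
    (⁅leftE, rightE⁆ = 0 ∧ ⁅leftE, rightH⁆ = 0 ∧ ⁅leftE, rightF⁆ = 0) ∧
    (⁅leftH, rightE⁆ = 0 ∧ ⁅leftH, rightH⁆ = 0 ∧ ⁅leftH, rightF⁆ = 0) ∧
    (⁅leftF, rightE⁆ = 0 ∧ ⁅leftF, rightH⁆ = 0 ∧ ⁅leftF, rightF⁆ = 0) := by
  refine ⟨⟨?_, ?_, ?_⟩, ⟨?_, ?_, ?_⟩, ⟨?_, ?_, ?_⟩, ⟨?_, ?_, ?_⟩, ⟨?_, ?_, ?_⟩⟩ <;>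
  refine derivation_ext ?_ ?_ fun l => ?_ <;>
  · simp only [leftE, leftH, leftF, rightE, rightH, rightF, Derivation.commutator_apply,
      Derivation.add_apply, Derivation.sub_apply, Derivation.neg_apply, Derivation.smul_apply,
      Derivation.zero_apply, two_smul, neg_smul, smul_eq_mul, map_add, map_sub, map_neg, map_zero,
      Derivation.leibniz, Derivation.map_one_eq_zero, Derivation.map_intCast, partialDeriv_x_x,
      partialDeriv_x_y, partialDeriv_y_x, partialDeriv_y_y, partialDeriv_zeta, euler_x, euler_y,
      euler_zeta]
    push_cast
    ring

/-- The left regular action `π_l` of `sl₂`. -/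
def leftAction : SL2 →ₗ⁅ℂ⁆ Derivation ℂ Functions Functions :=
  SL2.lift leftE leftH leftF commutators.1.1 commutators.1.2.1 commutators.1.2.2

/-- The right regular action `π_r` of `sl₂`. -/
def rightAction : SL2 →ₗ⁅ℂ⁆ Derivation ℂ Functions Functions :=
  SL2.lift rightE rightH rightF commutators.2.1.1 commutators.2.1.2.1 commutators.2.1.2.2

theorem left_right_commute (X Y : SL2) : ⁅leftAction X, rightAction Y⁆ = 0 := by
  obtain ⟨-, -, h1, h2, h3⟩ := commutators
  exact SL2.lift_commute _ _ _ _ _ _ h1 h2 h3 X Y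

/-- The diagonal action `X ↦ π_l(X) + π_r(X)` of `sl₂`. -/
def diagonalAction : SL2 →ₗ⁅ℂ⁆ Derivation ℂ Functions Functions :=
  SL2.sum leftAction rightAction left_right_commute

end BigCell

/-! ## The target algebra -/

/-- The algebra `ℂ[P]^W`: here `P ≅ ℤ` is the weight lattice of `sl₂`, the element `T λ` of
`ℂ[T, T⁻¹]` is the basis element of the group algebra `ℂ[P]` attached to `λ ∈ P`, and the
nontrivial element of the Weyl group `W ≅ ℤ/2` acts by `λ ↦ -λ`. -/
def weylInvariants : Subalgebra ℂ ℂ[T;T⁻¹] :=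
  AlgHom.equalizer (LaurentPolynomial.invert (R := ℂ)).toAlgHom (AlgHom.id ℂ ℂ[T;T⁻¹])

/-- The commutative superalgebra `ℂ[P]^W ⊗ ⋀ ℂ²`. -/
abbrev Target : Type := weylInvariants ⊗[ℂ] ExteriorAlgebra ℂ (Fin 2 → ℂ)

/-- The component `ℂ[P]^W ⊗ ⋀ⁿ ℂ²` of degree `n`. -/
def targetDeg (n : ℕ) : Submodule ℂ Target :=
  LinearMap.range (TensorProduct.map (LinearMap.id : weylInvariants →ₗ[ℂ] weylInvariants)
    (⋀[ℂ]^n (Fin 2 → ℂ)).subtype)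

end

/-!
In the coordinates `t = ζ (x + y)` (the trace), `ζ` and `z = (y - x) / 2` the algebra `𝔽` becomes
`ℂ[t][ζ, ζ⁻¹][z]`; the derivation `e` becomes `∂/∂z`, `h` becomes `2 (ζ ∂/∂ζ - z ∂/∂z)`, and `f`
agrees with `z h` on the functions of `t` and `ζ`. Subtracting coboundaries, one therefore reduces
every cocycle to functions killed by `e`, that is, to `ℂ[t][ζ, ζ⁻¹]`, on which only the weight
operator `h` remains: nonzero weights are exact, and the weight zero part is `ℂ[t]`. Hence the
cohomology is the exterior algebra over `ℂ[t] ≅ ℂ[P]^W` on the classes of `h' + z f'` and `ζ⁻¹ f'`.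
The two gradings cannot agree because `H¹(𝔤; ℂ) = 0` while `H¹(𝔤; 𝔽) ≠ 0`.
-/

noncomputable section

/-! ## Exterior algebras in coordinates -/

namespace ExteriorCoordinates

section Basis

variable {R M I : Type*} [CommRing R] [AddCommGroup M] [Module R M] [LinearOrder I]
  (b : Module.Basis I R M)

theorem basis_eq_prod_sort (s : Finset I) :
    b.ExteriorAlgebra s = (s.sort.map fun i => ExteriorAlgebra.ι R (b i)).prod := by
  rw [ExteriorAlgebra.basis_apply]
  change ExteriorAlgebra.ιMulti R s.card (b ∘ s.orderEmbOfFin rfl) = _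
  rw [ExteriorAlgebra.ιMulti_apply, ← s.listMap_orderEmbOfFin_finRange rfl,
    List.map_map, List.ofFn_eq_map]
  rfl

theorem basis_empty : b.ExteriorAlgebra ∅ = 1 := by
  rw [basis_eq_prod_sort, Finset.sort_empty, List.map_nil, List.prod_nil]

theorem basis_insert {i : I} {s : Finset I} (h : ∀ j ∈ s, i < j) :
    b.ExteriorAlgebra (insert i s) = ExteriorAlgebra.ι R (b i) * b.ExteriorAlgebra s := by
  rw [basis_eq_prod_sort, basis_eq_prod_sort,
    Finset.sort_insert _ (fun j hj => (h j hj).le) fun hi => (h i hi).false, List.map_cons,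
    List.prod_cons]

theorem basis_singleton (i : I) : b.ExteriorAlgebra {i} = ExteriorAlgebra.ι R (b i) := by
  rw [← insert_empty_eq, basis_insert b (by simp), basis_empty, mul_one]

theorem exteriorPower_eq_span (n : ℕ) :
    ⋀[R]^n M = Submodule.span R (b.ExteriorAlgebra '' {s | s.card = n}) := by
  have hrange : b.ExteriorAlgebra '' {s | s.card = n} =
      (⋀[R]^n M).subtype '' Set.range (b.exteriorPower n) := by
    rw [← Set.range_comp, Set.image_eq_range]
    exact congrArg Set.range (funext fun s => ExteriorAlgebra.basis_eq_coe_basis b s)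
  rw [hrange, Submodule.span_image, (b.exteriorPower n).span_eq, Submodule.map_top,
    Submodule.range_subtype]

end Basis

section Tensor

variable {R M N κ : Type*} [CommRing R] [AddCommGroup M] [Module R M] [AddCommGroup N]
  [Module R N] [DecidableEq κ] (b : Module.Basis κ R M)

theorem mem_range_map_span_image_subtype_iff {S : Set κ} {u : M ⊗[R] N} :
    u ∈ LinearMap.range (TensorProduct.map (Submodule.span R (b '' S)).subtype
        (LinearMap.id : N →ₗ[R] N)) ↔
      ∀ i ∉ S, TensorProduct.equivFinsuppOfBasisLeft b u i = 0 := by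
  constructor
  · rintro ⟨w, rfl⟩ i hi
    induction w with
    | zero => simp only [map_zero, Finsupp.zero_apply]
    | add w₁ w₂ h₁ h₂ => rw [map_add, map_add, Finsupp.add_apply, h₁, h₂, add_zero]
    | tmul m c =>
      have hm : b.repr m i = 0 :=
        Finsupp.notMem_support_iff.1 fun h => hi (b.mem_span_image.1 m.2 h)
      rw [TensorProduct.map_tmul, Submodule.subtype_apply,
        TensorProduct.equivFinsuppOfBasisLeft_apply_tmul_apply, hm, zero_smul]
  · intro h
    rw [← (TensorProduct.equivFinsuppOfBasisLeft b).symm_apply_apply u,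
      TensorProduct.equivFinsuppOfBasisLeft_symm_apply]
    refine Submodule.sum_mem _ fun i hi => ?_
    have hiS : i ∈ S := by_contra fun hi' => Finsupp.mem_support_iff.1 hi (h i hi')
    exact ⟨⟨b i, Submodule.subset_span ⟨i, hiS, rfl⟩⟩ ⊗ₜ _, TensorProduct.map_tmul _ _ _ _⟩

theorem mem_range_map_subtype_span_image_iff {S : Set κ} {u : N ⊗[R] M} :
    u ∈ LinearMap.range (TensorProduct.map (LinearMap.id : N →ₗ[R] N)
        (Submodule.span R (b '' S)).subtype) ↔
      ∀ i ∉ S, TensorProduct.equivFinsuppOfBasisRight b u i = 0 := by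
  have hcomm : TensorProduct.map (LinearMap.id : N →ₗ[R] N) (Submodule.span R (b '' S)).subtype =
      (TensorProduct.comm R M N).toLinearMap ∘ₗ
        TensorProduct.map (Submodule.span R (b '' S)).subtype LinearMap.id ∘ₗ
          (TensorProduct.comm R N (Submodule.span R (b '' S))).toLinearMap :=
    TensorProduct.ext' fun _ _ => rfl
  rw [hcomm, LinearMap.range_comp, LinearEquiv.range_comp, Submodule.mem_map_equiv,
    mem_range_map_span_image_subtype_iff]
  simp only [TensorProduct.equivFinsuppOfBasisLeft, LinearEquiv.trans_apply,
    LinearEquiv.apply_symm_apply]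

end Tensor

end ExteriorCoordinates

/-- The superalgebra `R ⊗ ⋀ k²` over the even algebra `R`. -/
abbrev ExteriorExtension (k R : Type*) [CommRing k] [Ring R] [Algebra k R] : Type _ :=
  R ⊗[k] ExteriorAlgebra k (Fin 2 → k)

namespace ExteriorExtension

variable (k : Type*) {R S : Type*} [CommRing k] [Ring R] [Algebra k R] [Ring S] [Algebra k S]

variable (R) in
/-- The component `R ⊗ ⋀ⁿ k²` of degree `n`. -/
def deg (n : ℕ) : Submodule k (ExteriorExtension k R) :=
  LinearMap.range (TensorProduct.map (LinearMap.id : R →ₗ[k] R) (⋀[k]^n (Fin 2 → k)).subtype)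

/-- The generators of the exterior algebra of `k²`. -/
def gen (i : Fin 2) : ExteriorAlgebra k (Fin 2 → k) := ExteriorAlgebra.ι k (Pi.basisFun k (Fin 2) i)

/-- The element with coordinate `r` in degree `0`, coordinates `s`, `t` in degree `1`, and
coordinate `q` in degree `2` with respect to the product of the generators. -/
def ofCoords (r s t q : R) : ExteriorExtension k R :=
  r ⊗ₜ 1 + (s ⊗ₜ gen k 0 + t ⊗ₜ gen k 1) + q ⊗ₜ (gen k 0 * gen k 1)

/-- The coordinates with respect to the ordered products of the generators. -/
def coordinates : ExteriorExtension k R ≃ₗ[k] Finset (Fin 2) →₀ R :=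
  TensorProduct.equivFinsuppOfBasisRight (Pi.basisFun k (Fin 2)).ExteriorAlgebra

theorem coordinates_ofCoords (r s t q : R) :
    coordinates k (ofCoords k r s t q) = Finsupp.single ∅ r +
      (Finsupp.single {0} s + Finsupp.single {1} t) + Finsupp.single {0, 1} q := by
  have h (I : Finset (Fin 2)) (a : R) :
      coordinates k (a ⊗ₜ (Pi.basisFun k (Fin 2)).ExteriorAlgebra I) = Finsupp.single I a := by
    rw [coordinates, TensorProduct.equivFinsuppOfBasisRight_apply_tmul, Module.Basis.repr_self,
      Finsupp.mapRange_single, one_smul]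
  simp only [← h, map_add, ← ExteriorCoordinates.basis_empty (Pi.basisFun k (Fin 2)), ofCoords, gen,
    ← ExteriorCoordinates.basis_singleton,
    ExteriorCoordinates.basis_insert (Pi.basisFun k (Fin 2)) (i := 0) (s := {1}) (by decide)]

theorem forall_finset_fin_two {P : Finset (Fin 2) → Prop} :
    (∀ I, P I) ↔ P ∅ ∧ (P {0} ∧ P {1}) ∧ P {0, 1} := by
  have huniv : (Finset.univ : Finset (Finset (Fin 2))) = {∅, {0}, {1}, {0, 1}} := by decide
  have hall : (∀ I, P I) ↔ ∀ I ∈ (Finset.univ : Finset (Finset (Fin 2))), P I := by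
    simp only [Finset.mem_univ, forall_const]
  rw [hall, huniv]
  simp only [Finset.forall_mem_insert, Finset.mem_singleton, forall_eq, and_assoc]

theorem exists_eq_ofCoords (x : ExteriorExtension k R) : ∃ r s t q, x = ofCoords k r s t q := by
  refine ⟨coordinates k x ∅, coordinates k x {0}, coordinates k x {1}, coordinates k x {0, 1},
    (coordinates k).injective ?_⟩
  rw [coordinates_ofCoords]
  refine Finsupp.ext (forall_finset_fin_two.2 ?_)
  simp +decide

theorem ofCoords_mem_deg_iff {r s t q : R} {n : ℕ} : ofCoords k r s t q ∈ deg k R n ↔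
    (n ≠ 0 → r = 0) ∧ (n ≠ 1 → s = 0 ∧ t = 0) ∧ (n ≠ 2 → q = 0) := by
  rw [deg, ExteriorCoordinates.exteriorPower_eq_span (Pi.basisFun k (Fin 2)),
    ExteriorCoordinates.mem_range_map_subtype_span_image_iff]
  change (∀ I ∉ _, coordinates k (ofCoords k r s t q) I = 0) ↔ _
  rw [coordinates_ofCoords, forall_finset_fin_two]
  simp +decide [imp_and, eq_comm (b := n)]

theorem ofCoords_eq_zero_iff {r s t q : R} :
    ofCoords k r s t q = 0 ↔ r = 0 ∧ s = 0 ∧ t = 0 ∧ q = 0 := by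
  rw [← map_eq_zero_iff _ (coordinates k).injective, coordinates_ofCoords, DFunLike.ext_iff,
    forall_finset_fin_two]
  simp +decide [and_assoc]

theorem eq_zero_of_mem_deg_three {x : ExteriorExtension k R} (hx : x ∈ deg k R 3) : x = 0 := by
  obtain ⟨r, s, t, q, rfl⟩ := exists_eq_ofCoords k x
  obtain ⟨h₀, h₁, h₂⟩ := (ofCoords_mem_deg_iff k).1 hx
  obtain ⟨hs, ht⟩ := h₁ (by decide)
  exact (ofCoords_eq_zero_iff k).2 ⟨h₀ (by decide), hs, ht, h₂ (by decide)⟩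

variable {k}

/-- Extension of scalars along an isomorphism of the even parts. -/
def congr (e : R ≃ₐ[k] S) : ExteriorExtension k R ≃ₐ[k] ExteriorExtension k S :=
  Algebra.TensorProduct.congr e AlgEquiv.refl

theorem map_congr_deg (e : R ≃ₐ[k] S) (n : ℕ) :
    (deg k R n).map (congr e).toLinearMap = deg k S n := by
  have hcomp : (congr e).toLinearMap ∘ₗ
      TensorProduct.map (LinearMap.id : R →ₗ[k] R) (⋀[k]^n (Fin 2 → k)).subtype =
      TensorProduct.map (LinearMap.id : S →ₗ[k] S) (⋀[k]^n (Fin 2 → k)).subtype ∘ₗ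
        (TensorProduct.congr e.toLinearEquiv (.refl k (⋀[k]^n (Fin 2 → k)))).toLinearMap :=
    TensorProduct.ext' fun _ _ => rfl
  rw [deg, ← LinearMap.range_comp, hcomp, LinearEquiv.range_comp, deg]

end ExteriorExtension

/-! ## Laurent polynomials -/

namespace LaurentAlgebra

variable {k R S : Type*} [CommRing k] [CommRing R] [Algebra k R] [CommRing S] [Algebra k S]

variable (R) in
/-- The indeterminate of `R[T;T⁻¹]` as a unit. -/
def unitT : R[T;T⁻¹]ˣ := (AddMonoidAlgebra.of R ℤ).toHomUnits (Multiplicative.ofAdd 1)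

theorem unitT_zpow (n : ℤ) : ((unitT R ^ n : R[T;T⁻¹]ˣ) : R[T;T⁻¹]) = .T n := by
  rw [unitT, ← map_zpow, ← ofAdd_zsmul, smul_eq_mul, mul_one]
  rfl

/-- Evaluation of Laurent polynomials at a unit, as an algebra homomorphism. -/
def aeval (f : R →ₐ[k] S) (u : Sˣ) : R[T;T⁻¹] →ₐ[k] S where
  __ := LaurentPolynomial.eval₂ f.toRingHom u
  commutes' c := (LaurentPolynomial.eval₂_C _ _ _).trans (f.commutes c)

theorem aeval_C (f : R →ₐ[k] S) (u : Sˣ) (r : R) : aeval f u (.C r) = f r :=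
  LaurentPolynomial.eval₂_C _ _ _

theorem aeval_T (f : R →ₐ[k] S) (u : Sˣ) (n : ℤ) : aeval f u (.T n) = ((u ^ n : Sˣ) : S) :=
  LaurentPolynomial.eval₂_T _ _ _

theorem algHom_ext {φ ψ : R[T;T⁻¹] →ₐ[k] S}
    (hC : φ.comp (IsScalarTower.toAlgHom k R R[T;T⁻¹]) =
      ψ.comp (IsScalarTower.toAlgHom k R R[T;T⁻¹]))
    (hT : ∀ n, φ (.T n) = ψ (.T n)) : φ = ψ := by
  refine AlgHom.ext fun l => ?_
  induction l using LaurentPolynomial.induction_on' with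
  | add p q hp hq => rw [map_add, map_add, hp, hq]
  | C_mul_T n r =>
    rw [map_mul, map_mul, hT]
    exact congrArg (· * _) (DFunLike.congr_fun hC r)

end LaurentAlgebra

/-! ## The Weyl invariants -/

namespace WeylInvariants

open LaurentPolynomial

/-- The character `T + T⁻¹` of the two-dimensional representation. -/
def char : weylInvariants :=
  ⟨T 1 + T (-1), by
    change invert (T 1 + T (-1) : ℂ[T;T⁻¹]) = T 1 + T (-1)
    rw [map_add, invert_T, invert_T, neg_neg, add_comm]⟩

theorem T_add_T_neg_mem (n : ℕ) :
    (T n + T (-n) : ℂ[T;T⁻¹]) ∈ (Polynomial.aeval (R := ℂ) (T 1 + T (-1) : ℂ[T;T⁻¹])).range := by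
  have h : (T 1 * T (-1) : ℂ[T;T⁻¹]) = 1 := by rw [← T_add, add_neg_cancel, T_zero]
  refine ⟨Polynomial.dickson 1 1 n, ?_⟩
  have h2 := Polynomial.dickson_one_one_eval_add_inv (T 1 : ℂ[T;T⁻¹]) (T (-1)) h n
  rw [T_pow, T_pow, mul_one, mul_neg_one] at h2
  change Polynomial.aeval (T 1 + T (-1) : ℂ[T;T⁻¹]) _ = _
  rw [← h2, ← Polynomial.eval_map_algebraMap, Polynomial.map_dickson, map_one]

theorem add_invert_mem (f : ℂ[T;T⁻¹]) :
    f + invert f ∈ (Polynomial.aeval (R := ℂ) (T 1 + T (-1) : ℂ[T;T⁻¹])).range := by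
  induction f using LaurentPolynomial.induction_on' with
  | add p q hp hq =>
    rw [map_add, add_add_add_comm]
    exact add_mem hp hq
  | C_mul_T n a =>
    rw [map_mul, invert_C, invert_T, ← mul_add, ← smul_eq_C_mul]
    refine Subalgebra.smul_mem _ ?_ a
    rcases Int.eq_nat_or_neg n with ⟨m, rfl | rfl⟩
    · exact T_add_T_neg_mem m
    · rw [neg_neg, add_comm (T (-(m : ℤ)))]
      exact T_add_T_neg_mem m

theorem aeval_char_surjective : Function.Surjective (Polynomial.aeval (R := ℂ) char) := by
  rintro ⟨f, hf⟩
  obtain ⟨p, hp⟩ := add_invert_mem ((1 / 2 : ℂ) • f)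
  have hf' : invert f = f := hf
  refine ⟨p, Subtype.ext ?_⟩
  rw [map_smul, hf', ← add_smul, add_halves, one_smul] at hp
  rw [← Subalgebra.coe_val, ← Polynomial.aeval_algHom_apply]
  exact hp

theorem exists_add_inv (w : ℂ) : ∃ c : ℂˣ, (c : ℂ) + (c⁻¹ : ℂˣ) = w := by
  obtain ⟨s, hs⟩ := IsAlgClosed.exists_pow_nat_eq (w ^ 2 - 4) (n := 2) (by norm_num)
  have h : (w + s) / 2 * ((w - s) / 2) = 1 := by linear_combination -hs / 4
  refine ⟨⟨_, _, h, by rw [mul_comm, h]⟩, ?_⟩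
  change (w + s) / 2 + (w - s) / 2 = w
  ring

theorem aeval_char_injective : Function.Injective (Polynomial.aeval (R := ℂ) char) := by
  rw [injective_iff_map_eq_zero]
  intro p hp
  have h1 : Polynomial.aeval (T 1 + T (-1) : ℂ[T;T⁻¹]) p = 0 := by
    have := congrArg weylInvariants.val hp
    rwa [← Polynomial.aeval_algHom_apply, map_zero] at this
  refine Polynomial.funext fun w => ?_
  obtain ⟨c, rfl⟩ := exists_add_inv w
  have h2 := congrArg (eval₂ (RingHom.id ℂ) c) h1
  rw [Polynomial.aeval_def, Polynomial.hom_eval₂, map_add, eval₂_T, eval₂_T, map_zero] at h2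
  rw [Polynomial.eval_zero, ← h2, zpow_one, zpow_neg_one, Polynomial.eval]
  congr 1
  ext r
  simp

/-- `ℂ[P]^W` is the polynomial algebra in `T + T⁻¹`. -/
def equivPolynomial : weylInvariants ≃ₐ[ℂ] Polynomial ℂ :=
  (AlgEquiv.ofBijective (Polynomial.aeval char)
    ⟨aeval_char_injective, aeval_char_surjective⟩).symm

end WeylInvariants

/-! ## The cochain complex of `sl₂` in coordinates -/

namespace SL2

open LieCohomology

theorem lie_basis : ⁅basis 0, basis 1⁆ = (-2 : ℂ) • basis 0 ∧ ⁅basis 0, basis 2⁆ = basis 1 ∧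
    ⁅basis 1, basis 2⁆ = (-2 : ℂ) • basis 2 := by
  refine ⟨?_, ?_, ?_⟩ <;>
  · apply Subtype.ext
    ext i j
    fin_cases i <;> fin_cases j <;>
    simp [basis, coords, ofCoords, Ring.lie_def, Module.Basis.coe_ofEquivFun] <;> norm_num

/-- The exterior algebra of the dual of `sl₂`, the tensor factor of the cochains. -/
abbrev Forms : Type := ExteriorAlgebra ℂ (Module.Dual ℂ SL2)

/-- The one-forms `e'`, `h'`, `f'` dual to the standard basis, as elements of the exterior
algebra. -/
def form (i : Fin 3) : Forms := ExteriorAlgebra.ι ℂ (basis.coord i)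

theorem form_mul_self (i : Fin 3) : form i * form i = 0 := ExteriorAlgebra.ι_sq_zero _

theorem form_mul_swap (i j : Fin 3) : form j * form i = -(form i * form j) :=
  eq_neg_of_add_eq_zero_left (ExteriorAlgebra.ι_add_mul_swap _ _)

theorem form_mul_self_mul (i : Fin 3) (ω : Forms) : form i * (form i * ω) = 0 := by
  rw [← mul_assoc, form_mul_self, zero_mul]

theorem form_mul_swap_mul (i j : Fin 3) (ω : Forms) :
    form j * (form i * ω) = -(form i * (form j * ω)) := by
  rw [← mul_assoc, form_mul_swap, neg_mul, mul_assoc]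

theorem contract_form_mul (i j : Fin 3) (ω : Forms) :
    contract (basis j) (form i * ω) =
      (if j = i then ω else 0) - form i * contract (basis j) ω := by
  rw [form, contract_iota_mul, Module.Basis.coord_apply, Module.Basis.repr_self,
    Finsupp.single_apply, ite_smul, one_smul, zero_smul]

theorem contract_form (i j : Fin 3) :
    contract (basis j) (form i) = if j = i then (1 : Forms) else 0 := by
  rw [← mul_one (form i), contract_form_mul, contract_one, mul_zero, sub_zero]

theorem contract_smul (c : ℂ) (X : SL2) : contract (c • X) = c • contract X := by
  simp [contract]

theorem contract_zero : contract (0 : SL2) = 0 := by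
  simp [contract]

theorem wedge_coord (i : Fin 3) (ω : Forms) : wedge (basis.coord i) ω = form i * ω := rfl

section Coordinates

variable {A : Type} [CommRing A] [Algebra ℂ A]

/-- The cochain with coordinates `a` in degree `0`, `b` in degree `1` with respect to
`e', h', f'`, `c` in degree `2` with respect to `e'h', e'f', h'f'`, and `w` in degree `3` with
respect to `e'h'f'`. -/
def cochain (a : A) (b c : A × A × A) (w : A) : Cochains SL2 A :=
  1 ⊗ₜ a + (form 0 ⊗ₜ b.1 + form 1 ⊗ₜ b.2.1 + form 2 ⊗ₜ b.2.2) +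
    ((form 0 * form 1) ⊗ₜ c.1 + (form 0 * form 2) ⊗ₜ c.2.1 + (form 1 * form 2) ⊗ₜ c.2.2) +
    (form 0 * (form 1 * form 2)) ⊗ₜ w

/-- The basis of the exterior algebra formed by the ordered products of `e'`, `h'`, `f'`. -/
def formBasis : Module.Basis (Finset (Fin 3)) ℂ Forms := basis.dualBasis.ExteriorAlgebra

theorem formBasis_singleton (i : Fin 3) : formBasis {i} = form i := by
  rw [formBasis, ExteriorCoordinates.basis_singleton, Module.Basis.coe_dualBasis, form]

theorem formBasis_insert {i : Fin 3} {s : Finset (Fin 3)} (h : ∀ j ∈ s, i < j) :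
    formBasis (insert i s) = form i * formBasis s := by
  rw [formBasis, ExteriorCoordinates.basis_insert _ h, Module.Basis.coe_dualBasis, form]

theorem cochain_eq_formBasis (a : A) (b c : A × A × A) (w : A) :
    cochain a b c w = formBasis ∅ ⊗ₜ a +
      (formBasis {0} ⊗ₜ b.1 + formBasis {1} ⊗ₜ b.2.1 + formBasis {2} ⊗ₜ b.2.2) +
      (formBasis {0, 1} ⊗ₜ c.1 + formBasis {0, 2} ⊗ₜ c.2.1 + formBasis {1, 2} ⊗ₜ c.2.2) +
      formBasis {0, 1, 2} ⊗ₜ w := by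
  rw [formBasis_insert (i := 0) (s := {1, 2}) (by decide),
    formBasis_insert (i := 0) (s := {1}) (by decide),
    formBasis_insert (i := 0) (s := {2}) (by decide),
    formBasis_insert (i := 1) (s := {2}) (by decide),
    formBasis_singleton, formBasis_singleton, formBasis_singleton, formBasis,
    ExteriorCoordinates.basis_empty, cochain]

/-- The coordinates of a cochain with respect to `formBasis`. -/
def coordinates : Cochains SL2 A ≃ₗ[ℂ] Finset (Fin 3) →₀ A :=
  TensorProduct.equivFinsuppOfBasisLeft formBasis

theorem coordinates_cochain (a : A) (b c : A × A × A) (w : A) :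
    coordinates (cochain a b c w) = Finsupp.single ∅ a +
      (Finsupp.single {0} b.1 + Finsupp.single {1} b.2.1 + Finsupp.single {2} b.2.2) +
      (Finsupp.single {0, 1} c.1 + Finsupp.single {0, 2} c.2.1 + Finsupp.single {1, 2} c.2.2) +
      Finsupp.single {0, 1, 2} w := by
  have h (s : Finset (Fin 3)) (a : A) :
      coordinates (formBasis s ⊗ₜ a) = Finsupp.single s a := by
    rw [coordinates, TensorProduct.equivFinsuppOfBasisLeft_apply_tmul, Module.Basis.repr_self,
      Finsupp.mapRange_single, one_smul]
  rw [cochain_eq_formBasis]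
  simp only [map_add, h]

theorem forall_finset_fin_three {P : Finset (Fin 3) → Prop} :
    (∀ s, P s) ↔ (P ∅ ∧ (P {0} ∧ P {1} ∧ P {2}) ∧ (P {0, 1} ∧ P {0, 2} ∧ P {1, 2}) ∧
      P {0, 1, 2}) := by
  have huniv : (Finset.univ : Finset (Finset (Fin 3))) =
      {∅, {0}, {1}, {2}, {0, 1}, {0, 2}, {1, 2}, {0, 1, 2}} := by decide
  have hall : (∀ s, P s) ↔ ∀ s ∈ (Finset.univ : Finset (Finset (Fin 3))), P s := by
    simp only [Finset.mem_univ, forall_const]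
  rw [hall, huniv]
  simp only [Finset.forall_mem_insert, Finset.mem_singleton, forall_eq, and_assoc]

theorem cochain_inj {a a' : A} {b b' c c' : A × A × A} {w w' : A} :
    cochain a b c w = cochain a' b' c' w' ↔ a = a' ∧ b = b' ∧ c = c' ∧ w = w' := by
  rw [← coordinates.injective.eq_iff, coordinates_cochain, coordinates_cochain, DFunLike.ext_iff,
    forall_finset_fin_three]
  simp +decide [Prod.ext_iff]

theorem exists_eq_cochain (u : Cochains SL2 A) : ∃ a b c w, u = cochain a b c w := by
  refine ⟨coordinates u ∅, (coordinates u {0}, coordinates u {1}, coordinates u {2}),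
    (coordinates u {0, 1}, coordinates u {0, 2}, coordinates u {1, 2}),
    coordinates u {0, 1, 2}, coordinates.injective ?_⟩
  rw [coordinates_cochain]
  refine Finsupp.ext (forall_finset_fin_three.2 ?_)
  simp +decide

theorem cochain_mem_cochainsDeg_iff {a : A} {b c : A × A × A} {w : A} {n : ℕ} :
    cochain a b c w ∈ cochainsDeg SL2 A n ↔
      (n ≠ 0 → a = 0) ∧ (n ≠ 1 → b = 0) ∧ (n ≠ 2 → c = 0) ∧ (n ≠ 3 → w = 0) := by
  rw [cochainsDeg, ExteriorCoordinates.exteriorPower_eq_span basis.dualBasis,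
    ExteriorCoordinates.mem_range_map_span_image_subtype_iff]
  change (∀ s ∉ _, coordinates (cochain a b c w) s = 0) ↔ _
  rw [coordinates_cochain, forall_finset_fin_three]
  simp +decide [Prod.ext_iff, imp_and, eq_comm (b := n)]

theorem cochain_zero : cochain (0 : A) 0 0 0 = 0 := by
  simp only [cochain, Prod.fst_zero, Prod.snd_zero, TensorProduct.tmul_zero, add_zero]

theorem cochain_add (a a' : A) (b b' c c' : A × A × A) (w w' : A) :
    cochain a b c w + cochain a' b' c' w' = cochain (a + a') (b + b') (c + c') (w + w') := by
  simp only [cochain, Prod.fst_add, Prod.snd_add, TensorProduct.tmul_add]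
  abel

end Coordinates

section Differential

variable {A : Type} [CommRing A] [Algebra ℂ A] (π : SL2 →ₗ⁅ℂ⁆ Derivation ℂ A A)

theorem differential_tmul (ω : Forms) (a : A) :
    differential basis π (ω ⊗ₜ[ℂ] a) = (form 0 * ω) ⊗ₜ[ℂ] π (basis 0) a +
      (form 1 * ω) ⊗ₜ[ℂ] π (basis 1) a + (form 2 * ω) ⊗ₜ[ℂ] π (basis 2) a +
      ((2 : ℂ) • (form 0 * (form 1 * contract (basis 0) ω)) -
        form 0 * (form 2 * contract (basis 1) ω) +
        (2 : ℂ) • (form 1 * (form 2 * contract (basis 2) ω))) ⊗ₜ[ℂ] a := by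
  obtain ⟨heh, hef, hhf⟩ := lie_basis
  have hhe : ⁅basis 1, basis 0⁆ = (2 : ℂ) • basis 0 := by rw [← lie_skew, heh]; module
  have hfe : ⁅basis 2, basis 0⁆ = (-1 : ℂ) • basis 1 := by rw [← lie_skew, hef]; module
  have hfh : ⁅basis 2, basis 1⁆ = (2 : ℂ) • basis 2 := by rw [← lie_skew, hhf]; module
  simp only [differential, Fin.sum_univ_three, heh, hef, hhf, hhe, hfe, hfh, lie_self,
    contract_zero, contract_smul, LinearMap.sub_apply, LinearMap.add_apply, LinearMap.smul_apply,
    TensorProduct.map_tmul, LinearMap.comp_apply, LinearMap.zero_apply, LinearMap.id_apply,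
    Derivation.coeFn_coe, map_smul, wedge_coord, map_zero, TensorProduct.zero_tmul,
    form_mul_swap_mul 0 1, form_mul_swap_mul 0 2, form_mul_swap_mul 1 2, smul_neg,
    TensorProduct.add_tmul, TensorProduct.sub_tmul, ← TensorProduct.smul_tmul',
    TensorProduct.neg_tmul]
  module

/-- The component of degree `0` of the differential, in coordinates. -/
def grad (a : A) : A × A × A := (π (basis 0) a, π (basis 1) a, π (basis 2) a)

/-- The component of degree `1` of the differential, in coordinates. -/
def curl (b : A × A × A) : A × A × A :=
  (π (basis 0) b.2.1 - π (basis 1) b.1 + 2 * b.1, π (basis 0) b.2.2 - π (basis 2) b.1 - b.2.1,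
    π (basis 1) b.2.2 - π (basis 2) b.2.1 + 2 * b.2.2)

/-- The component of degree `2` of the differential, in coordinates. -/
def div (c : A × A × A) : A :=
  π (basis 0) c.2.2 - π (basis 1) c.2.1 + π (basis 2) c.1

theorem differential_cochain (a : A) (b c : A × A × A) (w : A) :
    differential basis π (cochain a b c w) = cochain 0 (grad π a) (curl π b) (div π c) := by
  simp only [cochain, grad, curl, div, differential_tmul, map_add, contract_one, contract_form,
    contract_form_mul, form_mul_self, form_mul_self_mul, form_mul_swap_mul 0 1,
    form_mul_swap_mul 0 2, form_mul_swap_mul 1 2, form_mul_swap 0 1, form_mul_swap 0 2,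
    form_mul_swap 1 2, mul_one, mul_zero, Fin.isValue, if_true, zero_ne_one, one_ne_zero, if_false,
    Fin.reduceEq, TensorProduct.tmul_add, TensorProduct.tmul_sub, TensorProduct.tmul_zero,
    TensorProduct.neg_tmul, mul_neg, neg_neg, TensorProduct.zero_tmul, smul_zero, sub_zero,
    zero_sub, add_zero, zero_add, neg_zero, smul_neg, add_neg_cancel, two_smul,
    two_mul, TensorProduct.add_tmul]
  abel

theorem h_e_apply (a : A) : π (basis 1) (π (basis 0) a) =
    π (basis 0) (π (basis 1) a) + 2 * π (basis 0) a := by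
  have h := DFunLike.congr_fun (congrArg π lie_basis.1) a
  rw [LieHom.map_lie, map_smul, Derivation.commutator_apply, Derivation.smul_apply, neg_smul,
    two_smul] at h
  linear_combination -h

theorem e_f_apply (a : A) : π (basis 0) (π (basis 2) a) =
    π (basis 2) (π (basis 0) a) + π (basis 1) a := by
  have h := DFunLike.congr_fun (congrArg π lie_basis.2.1) a
  rw [LieHom.map_lie, Derivation.commutator_apply] at h
  linear_combination h

theorem h_f_apply (a : A) : π (basis 1) (π (basis 2) a) =
    π (basis 2) (π (basis 1) a) - 2 * π (basis 2) a := by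
  have h := DFunLike.congr_fun (congrArg π lie_basis.2.2) a
  rw [LieHom.map_lie, map_smul, Derivation.commutator_apply, Derivation.smul_apply, neg_smul,
    two_smul] at h
  linear_combination h

end Differential

section Products

variable {A : Type} [CommRing A] [Algebra ℂ A]

theorem cochain_smul (a a' : A) (b c : A × A × A) (w : A) :
    cochain a 0 0 0 * cochain a' b c w = cochain (a * a') (a • b) (a • c) (a * w) := by
  simp [cochain, mul_add]

theorem cochain_one_mul_one (b b' : A × A × A) :
    cochain 0 b 0 0 * cochain 0 b' 0 0 = cochain 0 0 (b.1 * b'.2.1 - b.2.1 * b'.1,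
      b.1 * b'.2.2 - b.2.2 * b'.1, b.2.1 * b'.2.2 - b.2.2 * b'.2.1) 0 := by
  simp only [cochain, Prod.fst_zero, Prod.snd_zero, TensorProduct.tmul_zero, add_zero, zero_add,
    mul_add, add_mul, Algebra.TensorProduct.tmul_mul_tmul, form_mul_self, form_mul_swap 0 1,
    form_mul_swap 0 2, form_mul_swap 1 2, TensorProduct.zero_tmul, TensorProduct.neg_tmul,
    TensorProduct.tmul_sub]
  abel

theorem cochain_mem_cocycles_iff {π : SL2 →ₗ⁅ℂ⁆ Derivation ℂ A A} {a : A} {b c : A × A × A}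
    {w : A} : cochain a b c w ∈ cocycles basis π ↔ grad π a = 0 ∧ curl π b = 0 ∧ div π c = 0 := by
  change differential basis π _ = 0 ↔ _
  rw [differential_cochain, ← cochain_zero, cochain_inj]
  simp only [true_and]

end Products

theorem cohomologyDeg_trivial_one_eq_bot {A : Type} [CommRing A] [Algebra ℂ A] :
    cohomologyDeg basis (0 : SL2 →ₗ⁅ℂ⁆ Derivation ℂ A A) 1 = ⊥ := by
  rw [Submodule.eq_bot_iff]
  rintro _ ⟨u, hu, rfl⟩
  suffices h : u = 0 by rw [h, map_zero]
  refine Subtype.ext ?_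
  obtain ⟨a, b, c, w, habcw⟩ := exists_eq_cochain (u : Cochains SL2 A)
  have hu : (u : Cochains SL2 A) ∈ cochainsDeg SL2 A 1 := hu
  have hcocycle := u.2
  rw [habcw, cochain_mem_cochainsDeg_iff] at hu
  rw [habcw, cochain_mem_cocycles_iff] at hcocycle
  obtain ⟨ha, -, hc, hw⟩ := hu
  have hcurl := hcocycle.2.1
  simp only [curl, LieHom.zero_apply, Derivation.zero_apply, sub_self, zero_add, zero_sub,
    Prod.mk_eq_zero, neg_eq_zero] at hcurl
  have htwo {a : A} (h : 2 * a = 0) : a = 0 := by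
    rwa [two_mul, ← two_smul ℂ, smul_eq_zero_iff_right two_ne_zero] at h
  have hb : b = 0 := Prod.ext (htwo hcurl.1) (Prod.ext hcurl.2.1 (htwo hcurl.2.2))
  rw [habcw, ha zero_ne_one.symm, hb, hc (by decide), hw (by decide), cochain_zero]
  rfl

/-! ## Trivialized actions -/

open Polynomial (X)

/-- An identification `A ≅ R[u, u⁻¹][z]` for which `e` acts as `∂/∂z`, `h` as
`2 (u ∂/∂u - z ∂/∂z)`, and `f` as `z h` on the functions of `u`. -/
structure Trivialization (R : Type*) {A : Type} [CommRing R] [Algebra ℂ R] [CommRing A]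
    [Algebra ℂ A] (π : SL2 →ₗ⁅ℂ⁆ Derivation ℂ A A) where
  equiv : Polynomial R[T;T⁻¹] ≃ₐ[ℂ] A
  e_C : ∀ l, π (basis 0) (equiv (Polynomial.C l)) = 0
  e_X : π (basis 0) (equiv X) = 1
  h_C_C_mul_T : ∀ r n, π (basis 1) (equiv (Polynomial.C (.C r * .T n))) =
    (2 * n : ℂ) • equiv (Polynomial.C (.C r * .T n))
  h_X : π (basis 1) (equiv X) = -2 * equiv X
  f_C : ∀ l, π (basis 2) (equiv (Polynomial.C l)) = equiv X * π (basis 1) (equiv (Polynomial.C l))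

namespace Trivialization

variable {R : Type*} {A : Type} [CommRing R] [Algebra ℂ R] [CommRing A] [Algebra ℂ A]
  {π : SL2 →ₗ⁅ℂ⁆ Derivation ℂ A A} (τ : Trivialization R π)

/-- The embedding of the functions of `u`, which are the functions killed by `e`. -/
def laurent : R[T;T⁻¹] →ₐ[ℂ] A := τ.equiv.toAlgHom.comp Polynomial.CAlgHom

/-- The embedding of the coefficient ring `R`, which consists of the invariants. -/
def const : R →ₐ[ℂ] A := τ.laurent.comp (IsScalarTower.toAlgHom ℂ R R[T;T⁻¹])

/-- The coordinate `z`. -/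
def z : A := τ.equiv X

/-- The coordinate `u`. -/
def u : A := τ.laurent (.T 1)

/-- The inverse `u⁻¹` of the coordinate `u`. -/
def v : A := τ.laurent (.T (-1))

theorem laurent_C (r : R) : τ.laurent (.C r) = τ.const r := rfl

theorem laurent_injective : Function.Injective τ.laurent :=
  τ.equiv.injective.comp Polynomial.C_injective

theorem const_injective : Function.Injective τ.const :=
  τ.laurent_injective.comp fun r s h => by
    simpa using congrArg (fun l : R[T;T⁻¹] => l.coeff 0) h

theorem u_mul_v : τ.u * τ.v = 1 := by
  rw [u, v, ← map_mul, ← LaurentPolynomial.T_add, add_neg_cancel, LaurentPolynomial.T_zero,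
    map_one]

theorem e_laurent (l : R[T;T⁻¹]) : π (basis 0) (τ.laurent l) = 0 := τ.e_C l

theorem h_laurent_C_mul_T (r : R) (n : ℤ) :
    π (basis 1) (τ.laurent (.C r * .T n)) = (2 * n : ℂ) • τ.laurent (.C r * .T n) :=
  τ.h_C_C_mul_T r n

theorem e_equiv (b : Polynomial R[T;T⁻¹]) :
    π (basis 0) (τ.equiv b) = τ.equiv (Polynomial.derivative b) := by
  induction b using Polynomial.induction_on' with
  | add p q hp hq => simp only [map_add, hp, hq]
  | monomial n l =>
    rw [← Polynomial.C_mul_X_pow_eq_monomial, Polynomial.derivative_C_mul_X_pow, map_mul, map_pow,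
      Derivation.leibniz, Derivation.leibniz_pow, τ.e_C, τ.e_X, map_mul, map_mul, map_mul, map_pow,
      map_natCast, map_natCast]
    simp only [smul_eq_mul, mul_one, mul_zero, add_zero, nsmul_eq_mul, mul_assoc]

theorem e_surjective (τ : Trivialization R π) : Function.Surjective (π (basis 0)) := by
  intro a
  obtain ⟨b, rfl⟩ := τ.equiv.surjective a
  suffices h : ∃ c, Polynomial.derivative c = b by
    obtain ⟨c, rfl⟩ := h
    exact ⟨τ.equiv c, τ.e_equiv c⟩
  induction b using Polynomial.induction_on' with
  | add p q hp hq =>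
    obtain ⟨c, rfl⟩ := hp
    obtain ⟨d, rfl⟩ := hq
    exact ⟨c + d, map_add _ c d⟩
  | monomial n l =>
    have hn : (n + 1 : ℂ) ≠ 0 := Nat.cast_add_one_ne_zero n
    refine ⟨Polynomial.monomial (n + 1) ((n + 1 : ℂ)⁻¹ • l), ?_⟩
    rw [Polynomial.derivative_monomial, Nat.add_sub_cancel, ← nsmul_eq_mul',
      ← Nat.cast_smul_eq_nsmul ℂ, Nat.cast_succ, smul_inv_smul₀ hn]

theorem e_eq_zero_iff {k : A} : π (basis 0) k = 0 ↔ ∃ l, k = τ.laurent l := by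
  refine ⟨fun h => ?_, ?_⟩
  · obtain ⟨b, rfl⟩ := τ.equiv.surjective k
    rw [e_equiv, map_eq_zero_iff _ τ.equiv.injective] at h
    have : Module ℚ R[T;T⁻¹] := Module.compHom _ (algebraMap ℚ ℂ)
    have : IsAddTorsionFree R[T;T⁻¹] := .of_module_rat _
    refine ⟨b.coeff 0, congrArg τ.equiv ?_⟩
    exact Polynomial.eq_C_of_natDegree_eq_zero (Polynomial.derivative_eq_zero.1 h)
  · rintro ⟨l, rfl⟩
    exact τ.e_laurent l

theorem f_of_e_eq_zero {k : A} (hk : π (basis 0) k = 0) :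
    π (basis 2) k = τ.z * π (basis 1) k := by
  obtain ⟨l, rfl⟩ := τ.e_eq_zero_iff.1 hk
  exact τ.f_C l

theorem exists_h_laurent (l : R[T;T⁻¹]) : ∃ m : R[T;T⁻¹],
    π (basis 1) (τ.laurent l) = τ.laurent m ∧ ∀ n, m.coeff n = (2 * n : ℂ) • l.coeff n := by
  induction l using LaurentPolynomial.induction_on' with
  | add p q hp hq =>
    obtain ⟨m, hm, hpm⟩ := hp
    obtain ⟨k, hk, hqk⟩ := hq
    refine ⟨m + k, by simp only [map_add, hm, hk], fun n => ?_⟩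
    rw [AddMonoidAlgebra.coeff_add, Finsupp.add_apply, hpm, hqk, AddMonoidAlgebra.coeff_add,
      Finsupp.add_apply, smul_add]
  | C_mul_T n r =>
    refine ⟨(2 * n : ℂ) • (.C r * .T n), by rw [h_laurent_C_mul_T, map_smul], fun k => ?_⟩
    rcases eq_or_ne k n with rfl | hkn
    · rfl
    · rw [AddMonoidAlgebra.coeff_smul, Finsupp.smul_apply, ← LaurentPolynomial.single_eq_C_mul_T,
        AddMonoidAlgebra.coeff_single, Finsupp.single_eq_of_ne hkn, smul_zero, smul_zero]

theorem exists_eq_const_add_h {k : A} (hk : π (basis 0) k = 0) :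
    ∃ r k', π (basis 0) k' = 0 ∧ k = τ.const r + π (basis 1) k' := by
  obtain ⟨l, rfl⟩ := τ.e_eq_zero_iff.1 hk
  clear hk
  induction l using LaurentPolynomial.induction_on' with
  | add p q hp hq =>
    obtain ⟨r, k, hk, hp⟩ := hp
    obtain ⟨s, j, hj, hq⟩ := hq
    refine ⟨r + s, k + j, by rw [map_add, hk, hj, add_zero], ?_⟩
    rw [map_add, hp, hq, map_add, map_add, add_add_add_comm]
  | C_mul_T n r =>
    by_cases hn : n = 0
    · refine ⟨r, 0, map_zero _, ?_⟩
      rw [hn, LaurentPolynomial.T_zero, mul_one, laurent_C, map_zero, add_zero]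
    · refine ⟨0, (2 * n : ℂ)⁻¹ • τ.laurent (.C r * .T n), ?_, ?_⟩
      · rw [Derivation.map_smul, e_laurent, smul_zero]
      · rw [Derivation.map_smul, h_laurent_C_mul_T, inv_smul_smul₀, map_zero, zero_add]
        exact mul_ne_zero two_ne_zero (Int.cast_ne_zero.2 hn)

theorem exists_eq_const_of_h_eq_const {k : A} {r : R} (hk : π (basis 0) k = 0)
    (h : π (basis 1) k = τ.const r) : r = 0 ∧ ∃ s, k = τ.const s := by
  obtain ⟨l, rfl⟩ := τ.e_eq_zero_iff.1 hk
  obtain ⟨m, hm, hcoeff⟩ := τ.exists_h_laurent l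
  rw [hm, ← laurent_C] at h
  obtain rfl := τ.laurent_injective h
  simp only [LaurentPolynomial.C_apply] at hcoeff
  constructor
  · simpa only [if_pos, Int.cast_zero, mul_zero, zero_smul] using hcoeff 0
  · refine ⟨l.coeff 0, congrArg τ.laurent ?_⟩
    ext n
    by_cases hn : n = 0
    · rw [hn]
      simp
    · have h2n : (2 * n : ℂ) ≠ 0 := mul_ne_zero two_ne_zero (Int.cast_ne_zero.2 hn)
      have hl := hcoeff n
      rw [if_neg hn, eq_comm, smul_eq_zero_iff_right h2n] at hl
      simp [LaurentPolynomial.C_apply, hn, hl]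

theorem e_const (r : R) : π (basis 0) (τ.const r) = 0 := τ.e_laurent _

theorem h_const (r : R) : π (basis 1) (τ.const r) = 0 := by
  have h := τ.h_laurent_C_mul_T r 0
  rwa [LaurentPolynomial.T_zero, mul_one, Int.cast_zero, mul_zero, zero_smul] at h

theorem f_const (r : R) : π (basis 2) (τ.const r) = 0 := by
  rw [τ.f_of_e_eq_zero (τ.e_const r), h_const, mul_zero]

theorem e_z : π (basis 0) τ.z = 1 := τ.e_X

theorem h_z : π (basis 1) τ.z = -2 * τ.z := τ.h_X

theorem e_u : π (basis 0) τ.u = 0 := τ.e_laurent _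

theorem h_u : π (basis 1) τ.u = 2 * τ.u := by
  have h := τ.h_laurent_C_mul_T 1 1
  rwa [map_one LaurentPolynomial.C, one_mul, Int.cast_one, mul_one, two_smul, ← two_mul] at h

theorem e_v : π (basis 0) τ.v = 0 := τ.e_laurent _

theorem h_v : π (basis 1) τ.v = -2 * τ.v := by
  have h := τ.h_laurent_C_mul_T 1 (-1)
  rwa [map_one LaurentPolynomial.C, one_mul, Int.cast_neg, Int.cast_one, mul_neg_one, neg_smul,
    two_smul, ← two_mul, ← neg_mul] at h

theorem h_u_mul (k : A) : π (basis 1) (τ.u * k) = τ.u * (π (basis 1) k + 2 * k) := by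
  rw [Derivation.leibniz, h_u, smul_eq_mul, smul_eq_mul]
  ring

theorem e_u_mul (k : A) : π (basis 0) (τ.u * k) = τ.u * π (basis 0) k := by
  rw [Derivation.leibniz, e_u, smul_zero, add_zero, smul_eq_mul]

theorem eq_mul_v_iff {k a : A} : k = a * τ.v ↔ τ.u * k = a := by
  constructor
  · rintro rfl
    linear_combination a * τ.u_mul_v
  · rintro rfl
    linear_combination -k * τ.u_mul_v

theorem exists_eq_const_mul_v_add {k : A} (hk : π (basis 0) k = 0) :
    ∃ s k', π (basis 0) k' = 0 ∧ k = τ.const s * τ.v + (π (basis 1) k' + 2 * k') := by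
  obtain ⟨s, j, hj, hsj⟩ := τ.exists_eq_const_add_h (k := τ.u * k) (by rw [e_u_mul, hk, mul_zero])
  refine ⟨s, τ.v * j, ?_, ?_⟩
  · rw [Derivation.leibniz, hj, e_v, smul_zero, smul_zero, add_zero]
  · rw [Derivation.leibniz, h_v, smul_eq_mul, smul_eq_mul]
    linear_combination -k * τ.u_mul_v + τ.v * hsj

theorem exists_eq_const_mul_v {k : A} {r : R} (hk : π (basis 0) k = 0)
    (h : π (basis 1) k + 2 * k = τ.const r * τ.v) : r = 0 ∧ ∃ s, k = τ.const s * τ.v := by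
  simp only [eq_mul_v_iff] at h ⊢
  exact τ.exists_eq_const_of_h_eq_const (by rw [e_u_mul, hk, mul_zero]) (by rw [h_u_mul, h])

theorem grad_eq_zero_iff {a : A} : grad π a = 0 ↔ ∃ r, a = τ.const r := by
  simp only [grad, Prod.mk_eq_zero]
  constructor
  · rintro ⟨he, hh, -⟩
    exact (τ.exists_eq_const_of_h_eq_const (r := 0) he (by rw [hh, map_zero])).2
  · rintro ⟨r, rfl⟩
    exact ⟨τ.e_const r, τ.h_const r, τ.f_const r⟩

/-- The coordinates of the one-cocycle `r (h' + z f') + s u⁻¹ f'`. -/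
def oneCocycle (r s : R) : A × A × A := (0, τ.const r, τ.const r * τ.z + τ.const s * τ.v)

/-- The coordinates of the two-cocycle `q u⁻¹ h' f'`, the product of `h' + z f'` and
`q u⁻¹ f'`. -/
def twoCocycle (q : R) : A × A × A := (0, 0, τ.const q * τ.v)

theorem exists_eq_grad_add {b : A × A × A} (hb : curl π b = 0) :
    ∃ p r s, b = grad π p + τ.oneCocycle r s := by
  obtain ⟨b₀, b₁, b₂⟩ := b
  simp only [curl, Prod.mk_eq_zero] at hb
  obtain ⟨hb₀, hb₁, hb₂⟩ := hb
  obtain ⟨p, rfl⟩ := τ.e_surjective b₀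
  obtain ⟨r, k, hk, hrk⟩ := τ.exists_eq_const_add_h (k := b₁ - π (basis 1) p) (by
    rw [map_sub]
    linear_combination hb₀ + h_e_apply π p)
  obtain ⟨p', hp', rfl⟩ : ∃ p', π (basis 0) p' = π (basis 0) p ∧
      τ.const r + π (basis 1) p' = b₁ :=
    ⟨p + k, by rw [map_add, hk, add_zero], by rw [map_add]; linear_combination -hrk⟩
  rw [← hp', map_add, f_const] at *
  obtain ⟨-, s, hs⟩ := τ.exists_eq_const_mul_v (r := 0)
    (k := b₂ - π (basis 2) p' - τ.const r * τ.z)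
    (by
      simp only [map_sub, Derivation.leibniz, e_z, e_const, smul_eq_mul]
      linear_combination hb₁ - e_f_apply π p')
    (by
      simp only [map_sub, Derivation.leibniz, h_z, h_const, smul_eq_mul, map_zero]
      linear_combination hb₂ - h_f_apply π p')
  refine ⟨p', r, s, ?_⟩
  simp only [grad, oneCocycle, Prod.mk_add_mk, Prod.mk.injEq, add_zero, true_and]
  exact ⟨add_comm _ _, by linear_combination hs⟩

theorem exists_eq_curl_add {c : A × A × A} (hc : div π c = 0) :
    ∃ b q, c = curl π b + τ.twoCocycle q := by
  obtain ⟨c₀, c₁, c₂⟩ := c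
  simp only [div] at hc
  obtain ⟨q, rfl⟩ := τ.e_surjective c₀
  obtain ⟨w, hw⟩ := τ.e_surjective (c₁ + q)
  obtain rfl := eq_sub_of_add_eq hw.symm
  obtain ⟨s, k, hk, hsk⟩ := τ.exists_eq_const_mul_v_add
    (k := c₂ - (π (basis 1) w - π (basis 2) q + 2 * w)) (by
      rw [map_sub] at hc
      simp only [map_sub, map_add, two_mul]
      linear_combination hc + h_e_apply π w + e_f_apply π q)
  refine ⟨(0, q, w + k), s, ?_⟩
  simp only [curl, twoCocycle, Prod.mk_add_mk, Prod.mk.injEq, map_zero, map_add, hk]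
  exact ⟨by ring, by ring, by linear_combination hsk⟩

theorem div_surjective (τ : Trivialization R π) : Function.Surjective (div π) := by
  intro w
  obtain ⟨c, rfl⟩ := τ.e_surjective w
  exact ⟨(0, 0, c), by rw [div, map_zero (π _), map_zero (π _), sub_zero, add_zero]⟩

theorem eq_zero_of_grad_eq_oneCocycle {a : A} {r s : R} (h : grad π a = τ.oneCocycle r s) :
    r = 0 ∧ s = 0 := by
  simp only [grad, oneCocycle, Prod.mk.injEq] at h
  obtain ⟨he, hh, hf⟩ := h
  obtain ⟨rfl, -⟩ := τ.exists_eq_const_of_h_eq_const he hh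
  rw [τ.f_of_e_eq_zero he, hh, map_zero, mul_zero, zero_mul, zero_add, eq_mul_v_iff, mul_zero,
    ← map_zero τ.const] at hf
  exact ⟨rfl, (τ.const_injective hf).symm⟩

theorem eq_zero_of_curl_eq_twoCocycle {b : A × A × A} {q : R} (h : curl π b = τ.twoCocycle q) :
    q = 0 := by
  obtain ⟨b₀, b₁, b₂⟩ := b
  simp only [curl, twoCocycle, Prod.mk.injEq] at h
  obtain ⟨h₀, h₁, h₂⟩ := h
  obtain ⟨p, rfl⟩ := τ.e_surjective b₀
  have he : π (basis 0) (b₁ - π (basis 1) p) = 0 := by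
    rw [map_sub]
    linear_combination h₀ + h_e_apply π p
  have hf := τ.f_of_e_eq_zero he
  refine (τ.exists_eq_const_mul_v
    (k := b₂ - π (basis 2) p - τ.z * (b₁ - π (basis 1) p)) ?_ ?_).1
  · rw [map_sub, map_sub, Derivation.leibniz, he, e_z, smul_zero, zero_add, smul_eq_mul]
    linear_combination h₁ - e_f_apply π p
  · rw [map_sub, map_sub, Derivation.leibniz, h_z, smul_eq_mul, smul_eq_mul]
    rw [map_sub] at hf
    linear_combination h₂ - h_f_apply π p + hf

theorem curl_oneCocycle (r s : R) : curl π (τ.oneCocycle r s) = 0 := by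
  simp only [curl, oneCocycle, map_add, map_zero, Derivation.leibniz, e_const, h_const, f_const,
    e_z, h_z, e_v, h_v, smul_eq_mul, Prod.mk_eq_zero]
  refine ⟨?_, ?_, ?_⟩ <;> ring

/-- The cocycles of degree zero given by the invariants. -/
def constCocycle : R →ₐ[ℂ] cocycles basis π :=
  (Algebra.TensorProduct.includeRight.comp τ.const).codRestrict _ fun r => by
    have h : cochain (τ.const r) 0 0 0 ∈ cocycles basis π :=
      cochain_mem_cocycles_iff.2 ⟨τ.grad_eq_zero_iff.2 ⟨r, rfl⟩, by simp [curl], by simp [div]⟩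
    simpa [cochain] using h

theorem coe_constCocycle (r : R) :
    (τ.constCocycle r : Cochains SL2 A) = cochain (τ.const r) 0 0 0 := by
  simp [constCocycle, cochain]

/-- The cocycles `h' + z f'` and `u⁻¹ f'` of degree one. -/
def genCocycle (i : Fin 2) : cocycles basis π :=
  ⟨cochain 0 (τ.oneCocycle (if i = 0 then 1 else 0) (if i = 0 then 0 else 1)) 0 0,
    cochain_mem_cocycles_iff.2 ⟨by simp [grad], τ.curl_oneCocycle _ _, by simp [div]⟩⟩

theorem genCocycle_mul_self (i : Fin 2) : τ.genCocycle i * τ.genCocycle i = 0 := by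
  refine Subtype.ext ?_
  rw [Subalgebra.coe_mul, genCocycle, cochain_one_mul_one, ZeroMemClass.coe_zero, ← cochain_zero]
  simp only [cochain_inj, Prod.mk_eq_zero, true_and, and_true]
  refine ⟨?_, ?_, ?_⟩ <;> ring

theorem genCocycle_mul_genCocycle :
    (τ.genCocycle 0 * τ.genCocycle 1 : Cochains SL2 A) = cochain 0 0 (τ.twoCocycle 1) 0 := by
  rw [genCocycle, genCocycle, cochain_one_mul_one]
  simp [oneCocycle, twoCocycle]

theorem genCocycle_mul_swap :
    τ.genCocycle 1 * τ.genCocycle 0 = -(τ.genCocycle 0 * τ.genCocycle 1) := by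
  rw [eq_neg_iff_add_eq_zero]
  refine Subtype.ext ?_
  rw [Subalgebra.coe_add, Subalgebra.coe_mul, Subalgebra.coe_mul, genCocycle, genCocycle,
    cochain_one_mul_one, cochain_one_mul_one, cochain_add, ZeroMemClass.coe_zero, ← cochain_zero]
  simp only [Prod.mk_add_mk, add_zero, cochain_inj, Prod.mk_eq_zero, true_and, and_true]
  refine ⟨?_, ?_, ?_⟩ <;> ring

/-- The homomorphism sending the generators of the exterior algebra to `genCocycle`. -/
def exteriorCocycle : ExteriorAlgebra ℂ (Fin 2 → ℂ) →ₐ[ℂ] cocycles basis π :=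
  ExteriorAlgebra.lift ℂ ⟨(Pi.basisFun ℂ (Fin 2)).constr ℂ τ.genCocycle, fun v => by
    simp only [Module.Basis.constr_apply_fintype, Fin.sum_univ_two, add_mul, mul_add,
      smul_mul_smul_comm, genCocycle_mul_self, genCocycle_mul_swap]
    module⟩

theorem exteriorCocycle_gen (i : Fin 2) :
    τ.exteriorCocycle (ExteriorExtension.gen ℂ i) = τ.genCocycle i := by
  rw [ExteriorExtension.gen, exteriorCocycle, ExteriorAlgebra.lift_ι_apply,
    Module.Basis.constr_basis]

theorem commute_constCocycle (r : R) (c : cocycles basis π) : Commute (τ.constCocycle r) c := by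
  refine Subtype.ext ?_
  change (1 ⊗ₜ τ.const r : Cochains SL2 A) * _ = _ * (1 ⊗ₜ τ.const r)
  generalize (c : Cochains SL2 A) = u
  induction u using TensorProduct.induction_on with
  | zero => rw [mul_zero, zero_mul]
  | add u v hu hv => rw [mul_add, add_mul, hu, hv]
  | tmul η a =>
    rw [Algebra.TensorProduct.tmul_mul_tmul, Algebra.TensorProduct.tmul_mul_tmul, one_mul,
      mul_one, mul_comm]

/-- The subalgebra of cocycles which represents the cohomology. -/
def toCocycles : ExteriorExtension ℂ R →ₐ[ℂ] cocycles basis π :=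
  Algebra.TensorProduct.lift τ.constCocycle τ.exteriorCocycle fun _ _ =>
    τ.commute_constCocycle _ _

theorem coe_toCocycles_ofCoords (r s t q : R) :
    (τ.toCocycles (ExteriorExtension.ofCoords ℂ r s t q) : Cochains SL2 A) =
      cochain (τ.const r) (τ.oneCocycle s t) (τ.twoCocycle q) 0 := by
  rw [ExteriorExtension.ofCoords, toCocycles]
  simp only [map_add, Algebra.TensorProduct.lift_tmul, map_one, map_mul, exteriorCocycle_gen,
    mul_one, Subalgebra.coe_add, Subalgebra.coe_mul, coe_constCocycle, genCocycle_mul_genCocycle]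
  simp only [genCocycle, cochain_smul, cochain_add]
  simp [oneCocycle, twoCocycle]

theorem exists_eq_differential_add {u : Cochains SL2 A} (hu : u ∈ cocycles basis π) :
    ∃ v x, u = differential basis π v + τ.toCocycles x := by
  obtain ⟨a, b, c, w, rfl⟩ := exists_eq_cochain u
  obtain ⟨ha, hb, hc⟩ := cochain_mem_cocycles_iff.1 hu
  obtain ⟨r, rfl⟩ := τ.grad_eq_zero_iff.1 ha
  obtain ⟨p, s, t, rfl⟩ := τ.exists_eq_grad_add hb
  obtain ⟨b', q, rfl⟩ := τ.exists_eq_curl_add hc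
  obtain ⟨c', rfl⟩ := τ.div_surjective w
  refine ⟨cochain p b' c' 0, .ofCoords ℂ r s t q, ?_⟩
  rw [differential_cochain, coe_toCocycles_ofCoords, cochain_add, zero_add, add_zero]

theorem mem_deg_of_differential_add_mem {v : Cochains SL2 A} {x : ExteriorExtension ℂ R} {n : ℕ}
    (h : differential basis π v + τ.toCocycles x ∈ cochainsDeg SL2 A n) :
    x ∈ ExteriorExtension.deg ℂ R n := by
  obtain ⟨a, b, c, w, rfl⟩ := exists_eq_cochain v
  obtain ⟨r, s, t, q, rfl⟩ := ExteriorExtension.exists_eq_ofCoords ℂ x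
  have hgrad : grad π (-a) = -grad π a := by
    simp only [grad, map_neg, Prod.neg_mk]
  have hcurl : curl π (-b) = -curl π b := by
    simp only [curl, Prod.fst_neg, Prod.snd_neg, map_neg, Prod.neg_mk, Prod.mk.injEq]
    refine ⟨?_, ?_, ?_⟩ <;> ring
  rw [differential_cochain, coe_toCocycles_ofCoords, cochain_add,
    cochain_mem_cochainsDeg_iff] at h
  obtain ⟨h₀, h₁, h₂, -⟩ := h
  refine (ExteriorExtension.ofCoords_mem_deg_iff ℂ).2 ⟨fun hn => ?_, fun hn => ?_, fun hn => ?_⟩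
  · exact (map_eq_zero_iff _ τ.const_injective).1 ((zero_add _).symm.trans (h₀ hn))
  · exact τ.eq_zero_of_grad_eq_oneCocycle (hgrad.trans (neg_eq_of_add_eq_zero_right (h₁ hn)))
  · exact τ.eq_zero_of_curl_eq_twoCocycle (hcurl.trans (neg_eq_of_add_eq_zero_right (h₂ hn)))

theorem coe_toCocycles_mem {x : ExteriorExtension ℂ R} {n : ℕ}
    (hx : x ∈ ExteriorExtension.deg ℂ R n) :
    (τ.toCocycles x : Cochains SL2 A) ∈ cochainsDeg SL2 A n := by
  obtain ⟨r, s, t, q, rfl⟩ := ExteriorExtension.exists_eq_ofCoords ℂ x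
  obtain ⟨h₀, h₁, h₂⟩ := (ExteriorExtension.ofCoords_mem_deg_iff ℂ).1 hx
  rw [coe_toCocycles_ofCoords, cochain_mem_cochainsDeg_iff]
  refine ⟨fun hn => ?_, fun hn => ?_, fun hn => ?_, fun _ => rfl⟩
  · rw [h₀ hn, map_zero]
  · obtain ⟨rfl, rfl⟩ := h₁ hn
    simp [oneCocycle]
  · simp [twoCocycle, h₂ hn]

/-- The homomorphism sending an element to the class of the cocycle `toCocycles` attaches to
it. -/
def toCohomology : ExteriorExtension ℂ R →ₐ[ℂ] Cohomology basis π :=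
  (Ideal.Quotient.mkₐ ℂ (coboundaries basis π)).comp τ.toCocycles

theorem toCohomology_injective : Function.Injective τ.toCohomology := by
  rw [injective_iff_map_eq_zero]
  intro x hx
  obtain ⟨v, hv⟩ := Ideal.Quotient.eq_zero_iff_mem.1 hx
  have hzero : differential basis π (-v) + τ.toCocycles x = 0 := by
    rw [map_neg, hv]
    exact neg_add_cancel _
  exact ExteriorExtension.eq_zero_of_mem_deg_three ℂ
    (τ.mem_deg_of_differential_add_mem (hzero ▸ zero_mem _))

theorem mk_eq_toCohomology {u : cocycles basis π} {v : Cochains SL2 A}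
    {x : ExteriorExtension ℂ R}
    (h : (u : Cochains SL2 A) = differential basis π v + τ.toCocycles x) :
    Ideal.Quotient.mkₐ ℂ (coboundaries basis π) u = τ.toCohomology x :=
  Ideal.Quotient.eq.2 ⟨v, eq_sub_of_add_eq h.symm⟩

theorem toCohomology_surjective : Function.Surjective τ.toCohomology := by
  intro y
  obtain ⟨u, rfl⟩ := Ideal.Quotient.mkₐ_surjective ℂ (coboundaries basis π) y
  obtain ⟨v, x, h⟩ := τ.exists_eq_differential_add u.2
  exact ⟨x, (τ.mk_eq_toCohomology h).symm⟩

theorem map_deg_toCohomology (n : ℕ) :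
    (ExteriorExtension.deg ℂ R n).map τ.toCohomology.toLinearMap = cohomologyDeg basis π n := by
  apply le_antisymm
  · rintro _ ⟨x, hx, rfl⟩
    exact ⟨τ.toCocycles x, τ.coe_toCocycles_mem hx, rfl⟩
  · rintro _ ⟨u, hu, rfl⟩
    obtain ⟨v, x, h⟩ := τ.exists_eq_differential_add u.2
    have hu : (u : Cochains SL2 A) ∈ cochainsDeg SL2 A n := hu
    exact ⟨x, τ.mem_deg_of_differential_add_mem (h ▸ hu), (τ.mk_eq_toCohomology h).symm⟩

/-- The cohomology algebra of a trivialized action is `R ⊗ ⋀ ℂ²`. -/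
def cohomologyEquiv : ExteriorExtension ℂ R ≃ₐ[ℂ] Cohomology basis π :=
  AlgEquiv.ofBijective τ.toCohomology ⟨τ.toCohomology_injective, τ.toCohomology_surjective⟩

theorem map_cohomologyDeg (n : ℕ) :
    (cohomologyDeg basis π n).map τ.cohomologyEquiv.symm.toLinearMap =
      ExteriorExtension.deg ℂ R n := by
  rw [← τ.map_deg_toCohomology, ← Submodule.map_comp]
  convert Submodule.map_id _
  exact LinearMap.ext τ.cohomologyEquiv.symm_apply_apply

theorem map_cohomologyDeg_trans_congr {S : Type*} [CommRing S] [Algebra ℂ S] (e : R ≃ₐ[ℂ] S)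
    (n : ℕ) : (cohomologyDeg basis π n).map
      (τ.cohomologyEquiv.symm.trans (ExteriorExtension.congr e)).toLinearMap =
      ExteriorExtension.deg ℂ S n := by
  rw [← ExteriorExtension.map_congr_deg e, ← τ.map_cohomologyDeg, ← Submodule.map_comp]
  rfl

theorem cohomologyDeg_one_ne_bot [Nontrivial R] (τ : Trivialization R π) :
    cohomologyDeg basis π 1 ≠ ⊥ := by
  intro hbot
  have hmem : ExteriorExtension.ofCoords ℂ 0 (1 : R) 0 0 ∈ ExteriorExtension.deg ℂ R 1 := by
    simp [ExteriorExtension.ofCoords_mem_deg_iff]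
  rw [← τ.map_cohomologyDeg, hbot, Submodule.map_bot, Submodule.mem_bot,
    ExteriorExtension.ofCoords_eq_zero_iff] at hmem
  exact one_ne_zero hmem.2.1

end Trivialization

end SL2

/-! ## Trivialization of the big cell -/

namespace BigCell

open SL2 (basis)

theorem diagonalAction_basis : diagonalAction (basis 0) = leftE + rightE ∧
    diagonalAction (basis 1) = leftH + rightH ∧ diagonalAction (basis 2) = leftF + rightF := by
  have h (X : SL2) : diagonalAction X =
      (X.val 0 1 • leftE + X.val 0 0 • leftH + X.val 1 0 • leftF) +
      (X.val 0 1 • rightE + X.val 0 0 • rightH + X.val 1 0 • rightF) := rfl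
  refine ⟨?_, ?_, ?_⟩ <;> rw [h] <;>
  simp [basis, SL2.coords, SL2.ofCoords, Module.Basis.coe_ofEquivFun]

theorem e_x : diagonalAction (basis 0) x = -1 := by
  simp [diagonalAction_basis, leftE, rightE, partialDeriv_x_x, partialDeriv_y_x]

theorem e_y : diagonalAction (basis 0) y = 1 := by
  simp [diagonalAction_basis, leftE, rightE, partialDeriv_x_y, partialDeriv_y_y]

theorem e_zeta (n : ℤ) : diagonalAction (basis 0) (zeta n) = 0 := by
  simp [diagonalAction_basis, leftE, rightE, partialDeriv_zeta]

theorem h_x : diagonalAction (basis 1) x = -2 * x := by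
  simp only [diagonalAction_basis, leftH, rightH, Derivation.add_apply, Derivation.sub_apply,
    Derivation.smul_apply, partialDeriv_x_x, partialDeriv_y_x, euler_x, smul_eq_mul, two_smul]
  ring

theorem h_y : diagonalAction (basis 1) y = -2 * y := by
  simp only [diagonalAction_basis, leftH, rightH, Derivation.add_apply, Derivation.sub_apply,
    Derivation.smul_apply, partialDeriv_x_y, partialDeriv_y_y, euler_y, smul_eq_mul, two_smul]
  ring

theorem h_zeta (n : ℤ) : diagonalAction (basis 1) (zeta n) = 2 * n * zeta n := by
  simp only [diagonalAction_basis, leftH, rightH, Derivation.add_apply, Derivation.sub_apply,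
    Derivation.smul_apply, partialDeriv_zeta, euler_zeta, smul_zero]
  ring

theorem f_x : diagonalAction (basis 2) x = x * x - zeta (-2) := by
  simp only [diagonalAction_basis, leftF, rightF, Derivation.add_apply, Derivation.sub_apply,
    Derivation.neg_apply, Derivation.smul_apply, partialDeriv_x_x, partialDeriv_y_x, euler_x,
    smul_eq_mul]
  ring

theorem f_y : diagonalAction (basis 2) y = zeta (-2) - y * y := by
  simp only [diagonalAction_basis, leftF, rightF, Derivation.add_apply, Derivation.sub_apply,
    Derivation.neg_apply, Derivation.smul_apply, partialDeriv_x_y, partialDeriv_y_y, euler_y,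
    smul_eq_mul]
  ring

theorem f_zeta (n : ℤ) : diagonalAction (basis 2) (zeta n) = n * (y - x) * zeta n := by
  simp only [diagonalAction_basis, leftF, rightF, Derivation.add_apply, Derivation.sub_apply,
    Derivation.neg_apply, Derivation.smul_apply, partialDeriv_zeta, euler_zeta, smul_eq_mul]
  ring

/-- The trace, as a function on the big cell. -/
def trace : Functions := zeta 1 * (x + y)

/-- The coordinate along the orbits of `e`. -/
def z : Functions := (1 / 2 : ℂ) • (y - x)

theorem two_mul_z : 2 * z = y - x := by
  rw [two_mul, z]
  module

theorem e_trace : diagonalAction (basis 0) trace = 0 := by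
  simp [trace, e_x, e_y, e_zeta]

theorem h_trace : diagonalAction (basis 1) trace = 0 := by
  simp only [trace, Derivation.leibniz, map_add, h_x, h_y, h_zeta, smul_eq_mul, Int.cast_one]
  ring

theorem f_trace : diagonalAction (basis 2) trace = 0 := by
  simp only [trace, Derivation.leibniz, map_add, f_x, f_y, f_zeta, smul_eq_mul, Int.cast_one]
  ring

theorem e_z : diagonalAction (basis 0) z = 1 := by
  rw [z, Derivation.map_smul, map_sub, e_x, e_y]
  module

theorem h_z : diagonalAction (basis 1) z = -2 * z := by
  rw [z, Derivation.map_smul, map_sub, h_x, h_y, mul_smul_comm, mul_sub]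

/-- The functions of the trace and `ζ`. -/
def ofLaurent : (Polynomial ℂ)[T;T⁻¹] →ₐ[ℂ] Functions :=
  LaurentAlgebra.aeval (Polynomial.aeval trace) (LaurentAlgebra.unitT _)

theorem ofLaurent_C (p : Polynomial ℂ) : ofLaurent (.C p) = Polynomial.aeval trace p :=
  LaurentAlgebra.aeval_C _ _ _

theorem ofLaurent_T (n : ℤ) : ofLaurent (.T n) = zeta n :=
  (LaurentAlgebra.aeval_T _ _ _).trans (LaurentAlgebra.unitT_zpow n)

theorem derivation_ofLaurent_C_mul_T {D : Derivation ℂ Functions Functions} (hD : D trace = 0)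
    (p : Polynomial ℂ) (n : ℤ) : D (ofLaurent (.C p * .T n)) = ofLaurent (.C p) * D (zeta n) := by
  rw [map_mul, Derivation.leibniz, ofLaurent_C, Derivation.map_aeval, hD, smul_zero, smul_zero,
    add_zero, ofLaurent_T, smul_eq_mul]

theorem e_ofLaurent (l : (Polynomial ℂ)[T;T⁻¹]) : diagonalAction (basis 0) (ofLaurent l) = 0 := by
  induction l using LaurentPolynomial.induction_on' with
  | add p q hp hq => rw [map_add, map_add, hp, hq, add_zero]
  | C_mul_T n p => rw [derivation_ofLaurent_C_mul_T e_trace, e_zeta, mul_zero]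

theorem h_ofLaurent_C_mul_T (p : Polynomial ℂ) (n : ℤ) :
    diagonalAction (basis 1) (ofLaurent (.C p * .T n)) =
      (2 * n : ℂ) • ofLaurent (.C p * .T n) := by
  rw [derivation_ofLaurent_C_mul_T h_trace, h_zeta, map_mul, ofLaurent_T, Algebra.smul_def,
    map_mul, map_ofNat, map_intCast]
  ring

theorem f_ofLaurent (l : (Polynomial ℂ)[T;T⁻¹]) : diagonalAction (basis 2) (ofLaurent l) =
    z * diagonalAction (basis 1) (ofLaurent l) := by
  induction l using LaurentPolynomial.induction_on' with
  | add p q hp hq => simp only [map_add, hp, hq, mul_add]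
  | C_mul_T n p =>
    rw [derivation_ofLaurent_C_mul_T f_trace, derivation_ofLaurent_C_mul_T h_trace, f_zeta, h_zeta,
      ← two_mul_z]
    ring

/-- The functions of the trace, `ζ` and `z`. -/
def ofPolynomial : Polynomial (Polynomial ℂ)[T;T⁻¹] →ₐ[ℂ] Functions :=
  Polynomial.aevalTower ofLaurent z

theorem ofPolynomial_C (l : (Polynomial ℂ)[T;T⁻¹]) :
    ofPolynomial (Polynomial.C l) = ofLaurent l :=
  Polynomial.aevalTower_C _ _ _

theorem ofPolynomial_X : ofPolynomial Polynomial.X = z := Polynomial.aevalTower_X _ _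

/-- The function `(x + y) / 2 = ζ⁻¹ t / 2` in terms of the trace `t` and `ζ`. -/
def mean : (Polynomial ℂ)[T;T⁻¹] := (1 / 2 : ℂ) • (.C Polynomial.X * .T (-1))

/-- The coordinates in terms of the trace, `ζ` and `z`. -/
def toPolynomial : Functions →ₐ[ℂ] Polynomial (Polynomial ℂ)[T;T⁻¹] :=
  LaurentAlgebra.aeval
    (MvPolynomial.aeval ![.C mean - Polynomial.X, .C mean + Polynomial.X])
    (Units.map Polynomial.C.toMonoidHom (LaurentAlgebra.unitT _))

theorem toPolynomial_x : toPolynomial x = .C mean - Polynomial.X :=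
  (LaurentAlgebra.aeval_C _ _ _).trans (MvPolynomial.aeval_X _ _)

theorem toPolynomial_y : toPolynomial y = .C mean + Polynomial.X :=
  (LaurentAlgebra.aeval_C _ _ _).trans (MvPolynomial.aeval_X _ _)

theorem toPolynomial_zeta (n : ℤ) : toPolynomial (zeta n) = .C (.T n) := by
  rw [zeta, toPolynomial, LaurentAlgebra.aeval_T, ← map_zpow, Units.coe_map,
    LaurentAlgebra.unitT_zpow]
  rfl

theorem toPolynomial_z : toPolynomial z = Polynomial.X := by
  rw [z, map_smul, map_sub, toPolynomial_x, toPolynomial_y]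
  module

theorem toPolynomial_trace : toPolynomial trace = .C (.C Polynomial.X) := by
  have hsum : toPolynomial (x + y) = .C (.C Polynomial.X * .T (-1)) := by
    rw [map_add, toPolynomial_x, toPolynomial_y, mean, ← Polynomial.smul_C]
    module
  rw [trace, map_mul, hsum, toPolynomial_zeta, ← map_mul, mul_left_comm, ← LaurentPolynomial.T_add,
    add_neg_cancel, LaurentPolynomial.T_zero, mul_one]

theorem toPolynomial_ofLaurent (l : (Polynomial ℂ)[T;T⁻¹]) :
    toPolynomial (ofLaurent l) = .C l := by
  suffices h : toPolynomial.comp ofLaurent = Polynomial.CAlgHom from DFunLike.congr_fun h l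
  apply LaurentAlgebra.algHom_ext (S := Polynomial (Polynomial ℂ)[T;T⁻¹])
  · apply Polynomial.algHom_ext
    change toPolynomial (ofLaurent (.C Polynomial.X)) = _
    rw [ofLaurent_C, Polynomial.aeval_X, toPolynomial_trace]
    rfl
  · intro n
    change toPolynomial (ofLaurent (.T n)) = _
    rw [ofLaurent_T, toPolynomial_zeta]
    rfl

theorem ofPolynomial_mean : ofPolynomial (.C mean) = (1 / 2 : ℂ) • (x + y) := by
  rw [ofPolynomial_C, mean, map_smul, map_mul, ofLaurent_C, ofLaurent_T, Polynomial.aeval_X, trace,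
    mul_right_comm, ← zeta_add, add_neg_cancel, zeta_zero, one_mul]

theorem ofPolynomial_comp_toPolynomial :
    ofPolynomial.comp toPolynomial = AlgHom.id ℂ Functions := by
  refine LaurentAlgebra.algHom_ext (MvPolynomial.algHom_ext fun i => ?_) fun n => ?_
  · fin_cases i
    · change ofPolynomial (toPolynomial x) = x
      rw [toPolynomial_x, map_sub ofPolynomial, ofPolynomial_mean, ofPolynomial_X, z]
      module
    · change ofPolynomial (toPolynomial y) = y
      rw [toPolynomial_y, map_add, ofPolynomial_mean, ofPolynomial_X, z]
      module
  · change ofPolynomial (toPolynomial (zeta n)) = zeta n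
    rw [toPolynomial_zeta, ofPolynomial_C, ofLaurent_T]

theorem toPolynomial_comp_ofPolynomial : toPolynomial.comp ofPolynomial = AlgHom.id ℂ _ := by
  refine Polynomial.algHom_ext' (AlgHom.ext fun l => ?_) ?_
  · change toPolynomial (ofPolynomial (.C l)) = .C l
    rw [ofPolynomial_C, toPolynomial_ofLaurent]
  · change toPolynomial (ofPolynomial Polynomial.X) = Polynomial.X
    rw [ofPolynomial_X, toPolynomial_z]

/-- The isomorphism `ℂ[t, ζ, ζ⁻¹, z] ≅ ℂ[x, y, ζ, ζ⁻¹]`, where `t` is the trace. -/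
def polynomialEquiv : Polynomial (Polynomial ℂ)[T;T⁻¹] ≃ₐ[ℂ] Functions :=
  AlgEquiv.ofAlgHom ofPolynomial toPolynomial ofPolynomial_comp_toPolynomial
    toPolynomial_comp_ofPolynomial

theorem polynomialEquiv_C (l : (Polynomial ℂ)[T;T⁻¹]) :
    polynomialEquiv (.C l) = ofLaurent l := ofPolynomial_C l

theorem polynomialEquiv_X : polynomialEquiv Polynomial.X = z := ofPolynomial_X

/-- The big cell as a family of free orbits of the Borel subalgebra, parametrized by the trace. -/
def trivialization : SL2.Trivialization (Polynomial ℂ) diagonalAction where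
  equiv := polynomialEquiv
  e_C l := by rw [polynomialEquiv_C, e_ofLaurent]
  e_X := by rw [polynomialEquiv_X, e_z]
  h_C_C_mul_T p n := by rw [polynomialEquiv_C, h_ofLaurent_C_mul_T]
  h_X := by rw [polynomialEquiv_X, h_z]
  f_C l := by rw [polynomialEquiv_C, polynomialEquiv_X, f_ofLaurent]

end BigCell

end

theorem mainTheorem7 :
    (∃ Φ : LieCohomology.Cohomology SL2.basis BigCell.diagonalAction ≃ₐ[ℂ] Target,
      ∀ n : ℕ, (LieCohomology.cohomologyDeg SL2.basis BigCell.diagonalAction n).map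
        Φ.toLinearMap = targetDeg n) ∧
    ¬ (∀ n : ℕ, Nonempty
        (LieCohomology.cohomologyDeg SL2.basis BigCell.diagonalAction n ≃ₗ[ℂ]
          LieCohomology.invariants BigCell.diagonalAction ⊗[ℂ]
            LieCohomology.cohomologyDeg SL2.basis
              (0 : SL2 →ₗ⁅ℂ⁆ Derivation ℂ ℂ ℂ) n)) := by
  refine ⟨⟨_, BigCell.trivialization.map_cohomologyDeg_trans_congr
    WeylInvariants.equivPolynomial.symm⟩, fun h => ?_⟩
  obtain ⟨e⟩ := h 1
  rw [SL2.cohomologyDeg_trivial_one_eq_bot] at e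
  have := e.toEquiv.subsingleton
  exact BigCell.trivialization.cohomologyDeg_one_ne_bot Submodule.eq_bot_of_subsingleton
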